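/- Let $m,n\in\mathbb N$, let $X=\{x_1,\dots,x_m\}$ be a set of $m$ distinct points of $\mathbb R^3$, and put $r_j=r_j(x):=|x-x_j|$. Let $H$ be the operator in $L^2(\mathbb R^3,\mathbb C^n)$ given by $$H:=-\Delta\otimes I_n,\qquad \operatorname{dom}(H):=\{f\in W^2_2(\mathbb R^3,\mathbb C^n):\ f(x_j)=0,\ j=1,\dots,m\},$$ where $f(x_j)$ is the value of the continuous representative of $f$. Recall that, for a closed densely defined symmetric operator $A$ with equal deficiency indices in a Hilbert space $\mathfrak H$, a triplet $\{\mathcal H,\Gamma_0,\Gamma_1\}$ is a boundary triplet for $A^*$ if $\mathcal H$ is a Hilbert space and $\Gamma_0,\Gamma_1:\operatorname{dom}(A^*)\to\mathcal H$ are linear maps such that $(A^*f,g)_{\mathfrak H}-(f,A^*g)_{\mathfrak H}=(\Gamma_1f,\Gamma_0g)_{\mathcal H}-(\Gamma_0f,\Gamma_1g)_{\mathcal H}$ for all $f,g\in\operatorname{dom}(A^*)$ and $f\mapsto(\Gamma_0f,\Gamma_1f)$ maps $\operatorname{dom}(A^*)$ onto $\mathcal H\oplus\mathcal H$ (scalar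 products are linear in the first argument). Then the following assertions hold. (i) The domain of $H^*$ is $$\operatorname{dom}(H^*)=\Bigl\{f=\sum_{j=1}^m\Bigl(\xi_{0j}\frac{e^{-r_j}}{r_j}+\xi_{1j}e^{-r_j}\Bigr)+f_H:\ \xi_{0j},\xi_{1j}\in\mathbb C^n,\ f_H\in\operatorname{dom}(H)\Bigr\},$$ and the sum is direct: if $\sum_{j=1}^m\bigl(\xi_{0j}\frac{e^{-r_j}}{r_j}+\xi_{1j}e^{-r_j}\bigr)\in\operatorname{dom}(H)$, then all $\xi_{0j}$ and $\xi_{1j}$ are zero. (ii) $H$ is closed, densely defined and symmetric with equal deficiency indices. Every $f\in\operatorname{dom}(H^*)$ has a representative that is continuous on $\mathbb R^3\setminus X$, and with this representative the limits $$\Gamma_0f:=4\pi\Bigl\{\lim_{x\to x_j}f(x)|x-x_j|\Bigr\}_{j=1}^m=4\pi\{\xi_{0j}\}_{j=1}^m,\qquad \Gamma_1f:=\Bigl\{\lim_{x\to x_j}\Bigl(f(x)-\frac{\xi_{0j}}{|x-x_j|}\Bigr)\Bigr\}_{j=1}^m$$ exist, where $\xi_{0j}$ are the coefficients of $f$ in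 (i). With $\mathcal H=\bigoplus_{j=1}^m\mathbb C^n$, the triplet $\{\mathcal H,\Gamma_0,\Gamma_1\}$ is a boundary triplet for $H^*$. (iii) The operator $H_0:=H^*\upharpoonright\ker(\Gamma_0)$ is self-adjoint, and $\operatorname{dom}(H_0)=W^2_2(\mathbb R^3,\mathbb C^n)$. -/

import Mathlib

open MeasureTheory Filter Topology
open scoped LinearPMap SchwartzMap LineDeriv Laplacian

noncomputable section

namespace PointInteraction

/-! ### Boundary triplets in an abstract Hilbert space -/

section Abstract

variable {E : Type*} [NormedAddCommGroup E] [InnerProductSpace ℂ E] [CompleteSpace E]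
variable {K : Type*} [NormedAddCommGroup K] [InnerProductSpace ℂ K] [CompleteSpace K]

/-- The defect subspace `ker (A* - z)`. -/
def defectSubspace (A : E →ₗ.[ℂ] E) (z : ℂ) : Submodule ℂ E :=
  A†.graph.comap (LinearMap.prod LinearMap.id (z • LinearMap.id))

/-- `{K, Γ₀, Γ₁}` is a boundary triplet for `A*`, where `A` is a closed densely defined symmetric
operator with equal deficiency indices. A scalar product `(f, g)` that is linear in its first
argument is written `inner ℂ g f`. -/
structure IsBoundaryTriplet (A : E →ₗ.[ℂ] E) (Γ₀ Γ₁ : A†.domain →ₗ[ℂ] K) : Prop where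
  dense : Dense (A.domain : Set E)
  closed : A.IsClosed
  symmetric : A ≤ A†
  deficiency : Nonempty (defectSubspace A Complex.I ≃ₗᵢ[ℂ] defectSubspace A (-Complex.I))
  green : ∀ f g : A†.domain,
    inner ℂ (g : E) (A† f) - inner ℂ (A† g) (f : E)
      = inner ℂ (Γ₀ g) (Γ₁ f) - inner ℂ (Γ₁ g) (Γ₀ f)
  surjective : Function.Surjective fun f : A†.domain => (Γ₀ f, Γ₁ f)

/-- The restriction of `A*` to the kernel of a linear map `Γ` on `dom A*`. -/
def adjointRestrictKer (A : E →ₗ.[ℂ] E) (Γ : A†.domain →ₗ[ℂ] K) : E →ₗ.[ℂ] E :=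
  A†.domRestrict ((LinearMap.ker Γ).map A†.domain.subtype)

end Abstract

/-! ### The minimal operator -/

/-- `ℝ³`. -/
abbrev R3 : Type := EuclideanSpace ℝ (Fin 3)

/-- `ℂⁿ`. -/
abbrev Cn (n : ℕ) : Type := EuclideanSpace ℂ (Fin n)

/-- `L²(ℝ³, ℂⁿ)`. -/
abbrev L2 (n : ℕ) : Type := Lp (Cn n) 2 (volume : Measure R3)

/-- The boundary space `⊕_{j=1}^m ℂⁿ`. -/
abbrev BdSpace (m n : ℕ) : Type := PiLp 2 fun _ : Fin m => Cn n

/-- The embedding of `L²(ℝ³, ℂⁿ)` into the tempered distributions. -/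
abbrev toDist (n : ℕ) : L2 n →L[ℂ] 𝓢'(R3, Cn n) :=
  Lp.toTemperedDistributionCLM (Cn n) volume 2

theorem toDist_injective (n : ℕ) : Function.Injective (toDist n) :=
  LinearMap.ker_eq_bot.mp (Lp.ker_toTemperedDistributionCLM_eq_bot (μ := volume) (p := 2))

/-- A distribution that is given by an `L²` function. -/
def IsL2 {n : ℕ} (T : 𝓢'(R3, Cn n)) : Prop := T ∈ LinearMap.range (toDist n).toLinearMap

/-- The Sobolev space `W²₂(ℝ³, ℂⁿ)`: the `L²` functions all of whose weak derivatives of order one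
and two are in `L²`. -/
def W22 (n : ℕ) : Submodule ℂ (L2 n) where
  carrier := {f | (∀ v : R3, IsL2 (∂_{v} (toDist n f))) ∧
    ∀ v w : R3, IsL2 (∂_{v} (∂_{w} (toDist n f)))}
  zero_mem' := by
    refine ⟨fun v => ?_, fun v w => ?_⟩
    · rw [map_zero, LineDeriv.lineDerivOp_zero]
      exact Submodule.zero_mem _
    · rw [map_zero, LineDeriv.lineDerivOp_zero, LineDeriv.lineDerivOp_zero]
      exact Submodule.zero_mem _
  add_mem' := by
    intro f g hf hg
    refine ⟨fun v => ?_, fun v w => ?_⟩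
    · rw [map_add, LineDeriv.lineDerivOp_add]
      exact Submodule.add_mem _ (hf.1 v) (hg.1 v)
    · rw [map_add, LineDeriv.lineDerivOp_add, LineDeriv.lineDerivOp_add]
      exact Submodule.add_mem _ (hf.2 v w) (hg.2 v w)
  smul_mem' := by
    intro c f hf
    refine ⟨fun v => ?_, fun v w => ?_⟩
    · rw [map_smul, LineDeriv.lineDerivOp_smul]
      exact Submodule.smul_mem _ c (hf.1 v)
    · rw [map_smul, LineDeriv.lineDerivOp_smul, LineDeriv.lineDerivOp_smul]
      exact Submodule.smul_mem _ c (hf.2 v w)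

theorem exists_neg_laplacian {n : ℕ} (f : W22 n) :
    ∃ g : L2 n, toDist n g = -Δ (toDist n (f : L2 n)) := by
  have h : IsL2 (-Δ (toDist n (f : L2 n))) := by
    rw [TemperedDistribution.laplacian_eq_sum (stdOrthonormalBasis ℝ R3)]
    exact Submodule.neg_mem _ (Submodule.sum_mem _ fun i _ => f.2.2 _ _)
  exact h

/-- The operator `-Δ ⊗ Iₙ` in `L²(ℝ³, ℂⁿ)` with domain `W²₂(ℝ³, ℂⁿ)`; its value at `f` is the
`L²` function that represents the distribution `-Δ f`. -/
def negLaplacian (n : ℕ) : L2 n →ₗ.[ℂ] L2 n where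
  domain := W22 n
  toFun :=
    { toFun := fun f => (exists_neg_laplacian f).choose
      map_add' := by
        intro f g
        apply toDist_injective n
        rw [map_add, (exists_neg_laplacian f).choose_spec, (exists_neg_laplacian g).choose_spec,
          (exists_neg_laplacian (f + g)).choose_spec, Submodule.coe_add, map_add,
          ← TemperedDistribution.laplacianCLM_apply, ← TemperedDistribution.laplacianCLM_apply,
          ← TemperedDistribution.laplacianCLM_apply, map_add, neg_add]
      map_smul' := by
        intro c f
        apply toDist_injective n
        rw [RingHom.id_apply, map_smul, (exists_neg_laplacian f).choose_spec,
          (exists_neg_laplacian (c • f)).choose_spec, Submodule.coe_smul, map_smul,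
          ← TemperedDistribution.laplacianCLM_apply, ← TemperedDistribution.laplacianCLM_apply,
          map_smul, smul_neg] }

theorem toDist_negLaplacian {n : ℕ} (f : (negLaplacian n).domain) :
    toDist n (negLaplacian n f) = -Δ (toDist n (f : L2 n)) :=
  (exists_neg_laplacian f).choose_spec

/-- The `L²` functions whose continuous representative exists and vanishes at every `x j`. -/
def vanishingAt {m : ℕ} (n : ℕ) (x : Fin m → R3) : Submodule ℂ (L2 n) where
  carrier := {f | ∃ u : R3 → Cn n, Continuous u ∧ (f : R3 → Cn n) =ᵐ[volume] u ∧ ∀ j, u (x j) = 0}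
  zero_mem' := ⟨0, continuous_zero, Lp.coeFn_zero _ _ _, fun _ => rfl⟩
  add_mem' := by
    rintro f g ⟨u, hu, hfu, hu0⟩ ⟨v, hv, hgv, hv0⟩
    exact ⟨u + v, hu.add hv, (Lp.coeFn_add f g).trans (hfu.add hgv), fun j => by
      simp [hu0 j, hv0 j]⟩
  smul_mem' := by
    rintro c f ⟨u, hu, hfu, hu0⟩
    exact ⟨c • u, hu.const_smul c, (Lp.coeFn_smul c f).trans (hfu.const_smul c), fun j => by
      simp [hu0 j]⟩

/-- The minimal operator `H = -Δ ⊗ Iₙ` with domain `{f ∈ W²₂ : f(x_j) = 0 for all j}`. -/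
def minimalOp {m : ℕ} (n : ℕ) (x : Fin m → R3) : L2 n →ₗ.[ℂ] L2 n :=
  (negLaplacian n).domRestrict (vanishingAt n x)

/-! ### The functions `ξ e^{-|y-a|}/|y-a|` and `ξ e^{-|y-a|}` -/

theorem memLp_radial {n : ℕ} (φ : ℝ → ℝ) (hφ : Measurable φ)
    (hint : IntegrableOn (fun r : ℝ => r ^ 2 * φ r ^ 2) (Set.Ioi 0)) (a : R3) (ξ : Cn n) :
    MemLp (fun y : R3 => ((φ ‖y - a‖ : ℝ) : ℂ) • ξ) 2 volume := by
  have h1 : Integrable (fun y : R3 => φ ‖y‖ ^ 2) volume := by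
    rw [integrable_fun_norm_addHaar volume (f := fun r => φ r ^ 2)]
    simpa using hint
  have h2 : MemLp (fun y : R3 => φ ‖y - a‖) 2 volume := by
    have hm : AEStronglyMeasurable (fun y : R3 => φ ‖y - a‖) volume :=
      Measurable.aestronglyMeasurable (by fun_prop)
    exact (memLp_two_iff_integrable_sq hm).mpr (h1.comp_sub_right a)
  have h3 : MemLp (fun y : R3 => ((φ ‖y - a‖ : ℝ) : ℂ)) 2 volume := h2.ofReal
  refine MemLp.of_le_mul (c := ‖ξ‖) h3 (h3.1.smul_const ξ) (Eventually.of_forall fun y => ?_)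
  rw [norm_smul, mul_comm]

theorem memLp_exp_div {n : ℕ} (a : R3) (ξ : Cn n) :
    MemLp (fun y : R3 => ((Real.exp (-‖y - a‖) / ‖y - a‖ : ℝ) : ℂ) • ξ) 2 volume := by
  refine memLp_radial (fun r => Real.exp (-r) / r) (by fun_prop) ?_ a ξ
  refine (exp_neg_integrableOn_Ioi 0 (b := 2) two_pos).congr_fun (fun r hr => ?_) measurableSet_Ioi
  have hr' : r ≠ 0 := ne_of_gt hr
  have : Real.exp (-2 * r) = Real.exp (-r) ^ 2 := by
    rw [← Real.exp_nat_mul]; congr 1; push_cast; ring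
  simp only [this]
  field_simp

theorem memLp_exp {n : ℕ} (a : R3) (ξ : Cn n) :
    MemLp (fun y : R3 => ((Real.exp (-‖y - a‖) : ℝ) : ℂ) • ξ) 2 volume := by
  refine memLp_radial (fun r => Real.exp (-r)) (by fun_prop) ?_ a ξ
  have h := (Real.GammaIntegral_convergent (s := 3) (by norm_num))
  refine Integrable.mono' h (by fun_prop) ?_
  refine (ae_restrict_iff' measurableSet_Ioi).mpr (Eventually.of_forall fun r hr => ?_)
  have hr' : (0 : ℝ) < r := hr
  have h1 : Real.exp (-r) ≤ 1 := Real.exp_le_one_iff.mpr (by linarith)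
  have h2 : r ^ ((3 : ℝ) - 1) = r ^ 2 := by norm_num
  have h3 : 0 < Real.exp (-r) := Real.exp_pos _
  rw [Real.norm_of_nonneg (by positivity), h2]
  nlinarith [mul_le_mul_of_nonneg_left h1 (by positivity : 0 ≤ r ^ 2 * Real.exp (-r))]

/-- The element `ξ e^{-|y-a|}/|y-a|` of `L²(ℝ³, ℂⁿ)`. -/
def expDiv {n : ℕ} (a : R3) (ξ : Cn n) : L2 n := (memLp_exp_div a ξ).toLp _

/-- The element `ξ e^{-|y-a|}` of `L²(ℝ³, ℂⁿ)`. -/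
def expDecay {n : ℕ} (a : R3) (ξ : Cn n) : L2 n := (memLp_exp a ξ).toLp _

/-- The sum `∑_j (ξ₀ⱼ e^{-r_j}/r_j + ξ₁ⱼ e^{-r_j})`, `r_j = |y - x_j|`. -/
def singularSum {m n : ℕ} (x : Fin m → R3) (ξ₀ ξ₁ : Fin m → Cn n) : L2 n :=
  ∑ j, (expDiv (x j) (ξ₀ j) + expDecay (x j) (ξ₁ j))

/-! ### Boundary values -/

/-- `h₀ = 4π {lim_{y → x_j} f(y) |y - x_j|}_j` and
`h₁ = {lim_{y → x_j} (f(y) - ξ₀ⱼ / |y - x_j|)}_j` with `ξ₀ⱼ = lim_{y → x_j} f(y) |y - x_j|`. All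
limits are required to exist, and the values `f(y)` are those of the representative of `f` that is
continuous off the points `x_j` (there is at most one such, up to its values at the `x_j`). -/
def HasBoundaryValues {m n : ℕ} (x : Fin m → R3) (f : L2 n) (h₀ h₁ : BdSpace m n) : Prop :=
  ∃ u : R3 → Cn n, ContinuousOn u (Set.range x)ᶜ ∧ (f : R3 → Cn n) =ᵐ[volume] u ∧
    ∀ j, ∃ ξ : Cn n,
      Tendsto (fun y => ((‖y - x j‖ : ℝ) : ℂ) • u y) (𝓝[≠] x j) (𝓝 ξ) ∧
      h₀ j = ((4 * Real.pi : ℝ) : ℂ) • ξ ∧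
      Tendsto (fun y => u y - ((‖y - x j‖⁻¹ : ℝ) : ℂ) • ξ) (𝓝[≠] x j) (𝓝 (h₁ j))

end PointInteraction

end

/-! Everything is expressed through the resolvent `R = (1 - Δ)⁻¹`, a bounded symmetric injective
operator with range `W22`, and the finite-rank map `G ξ = ∑ ξ_j e^{-r_j}/r_j`. Since `e^{-r}/(4πr)`
is the Green function of `1 - Δ`, the adjoint `G*` sends `g` to `4π` times the values of `R g` at
the points `x_j` (`exists_continuous_resolvent`). The conditions `f(x_j) = 0` on `f = R g` therefore
say `g ⊥ ran G`, and `H` is `R⁻¹ - 1` restricted to `R ((ran G)ᗮ)`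
(`isResolventRestriction_minimalOp`).

The rest is mostly operator theory. The elements of `dom H*` are the `f = G ξ + R g`, with `g = f +
H* f` (`mem_graph_adjoint_iff`). The decomposition is unique because `ran R` meets `ran G` only in
zero: functions in `ran R` are continuous, nonzero ones in `ran G` blow up at some `x_j`. Splitting
`g` along `ran G` and its complement, and using `R (2 e^{-r}/r) = e^{-r}`, gives (i). Near `x_j` the
function `f` is `ξ_j/r_j` plus the regular part of `G ξ` plus `(R g)(x_j)`, so `Γ₁ f = (4π)⁻¹ G* g +
M ξ` with a real symmetric matrix `M`. In Green's identity the terms with `R` and `M` cancel by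
symmetry. The kernel of `Γ₀` is `ξ = 0`, which leaves `R⁻¹ - 1` on all of `ran R`.

The analytic input is that the Fourier transforms of `e^{-r}/r` and `e^{-r}` are `4πσ` and `8πσ²`,
where `σ` is the symbol of `R`; both functions are written as integrals of heat kernels over time.
-/

namespace PointInteraction

/-! ### Restrictions of `R⁻¹ - 1`: adjoint, defect spaces, boundary triplet -/

section Abstract

variable {E : Type*} [NormedAddCommGroup E] [InnerProductSpace ℂ E]

/-- `H` is the restriction of `R⁻¹ - 1` to those `f` for which `R⁻¹ f` is orthogonal to `N`. -/
def IsResolventRestriction (R : E →L[ℂ] E) (N : Submodule ℂ E) (H : E →ₗ.[ℂ] E) : Prop :=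
  ∀ p : E × E, p ∈ H.graph ↔ R (p.1 + p.2) = p.1 ∧ p.1 + p.2 ∈ Nᗮ

variable {R : E →L[ℂ] E} {N : Submodule ℂ E} {H : E →ₗ.[ℂ] E}

namespace IsResolventRestriction

theorem mem_domain_iff (hH : IsResolventRestriction R N H) {f : E} :
    f ∈ H.domain ↔ ∃ g ∈ Nᗮ, R g = f := by
  rw [LinearPMap.mem_domain_iff]
  constructor
  · rintro ⟨h, hh⟩
    obtain ⟨h1, h2⟩ := (hH _).1 hh
    exact ⟨_, h2, h1⟩
  · rintro ⟨g, hg, rfl⟩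
    exact ⟨g - R g, (hH _).2 (by simpa using hg)⟩

theorem isClosed (hH : IsResolventRestriction R N H) : H.IsClosed := by
  have h : (H.graph : Set (E × E)) =
      {p | R (p.1 + p.2) = p.1} ∩ (fun p : E × E => p.1 + p.2) ⁻¹' (Nᗮ : Set E) := by
    ext p
    exact hH p
  rw [LinearPMap.IsClosed, h]
  exact (isClosed_eq (by fun_prop) (by fun_prop)).inter
    ((Submodule.isClosed_orthogonal N).preimage (by fun_prop))

theorem singularPart_unique {K : Type*} [NormedAddCommGroup K] [InnerProductSpace ℂ K]
    {G : K →L[ℂ] E} (hinj : ∀ f, R f ∈ G.range → f = 0) (hG : Function.Injective G)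
    {ξ η : K} {g h : E} (heq : G ξ + R g = G η + R h) : ξ = η ∧ g = h := by
  have h1 : R (g - h) = G (η - ξ) := by
    rw [map_sub, map_sub, sub_eq_sub_iff_add_eq_add, add_comm, heq]
  have h2 : g - h = 0 := hinj _ (h1 ▸ ⟨_, rfl⟩)
  rw [h2, map_zero] at h1
  have h3 : η - ξ = 0 := hG (by rw [← h1, map_zero])
  exact ⟨(sub_eq_zero.1 h3).symm, sub_eq_zero.1 h2⟩

variable [CompleteSpace E]

/-- If `f ⊥ R g` for all `g ∈ Nᗮ`, then `R f ∈ Nᗮᗮ = N`, which forces `f = 0`. -/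
theorem dense_domain (hH : IsResolventRestriction R N H) [N.HasOrthogonalProjection]
    (hR : R.IsSymmetric) (hinj : ∀ f, R f ∈ N → f = 0) : Dense (H.domain : Set E) := by
  rw [Submodule.dense_iff_topologicalClosure_eq_top, Submodule.topologicalClosure_eq_top_iff,
    Submodule.eq_bot_iff]
  intro f hf
  apply hinj
  rw [← Submodule.orthogonal_orthogonal N, Submodule.mem_orthogonal]
  intro g hg
  have := (Submodule.mem_orthogonal _ _).1 hf (R g) (hH.mem_domain_iff.2 ⟨g, hg, rfl⟩)
  rw [← this]
  exact (hR g f).symm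

/-- The graph of `H` consists of the pairs `(R g, g - R g)` with `g ∈ Nᗮ`. Moving `R` across the
inner product turns the adjoint relation for `p` into `g ⊥ p.1 - R (p.1 + p.2)` for all such `g`,
and `Nᗮᗮ = N`. -/
theorem mem_graph_adjoint_iff (hH : IsResolventRestriction R N H) [N.HasOrthogonalProjection]
    (hR : R.IsSymmetric) (hinj : ∀ f, R f ∈ N → f = 0) (p : E × E) :
    p ∈ H†.graph ↔ p.1 - R (p.1 + p.2) ∈ N := by
  rw [LinearPMap.adjoint_graph_eq_graph_adjoint (hH.dense_domain hR hinj),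
    Submodule.mem_adjoint_iff]
  have key : ∀ g : E, inner ℂ (g - R g) p.1 - inner ℂ (R g) p.2
      = inner ℂ g (p.1 - R (p.1 + p.2)) := by
    intro g
    have h1 : inner ℂ (R g) p.1 = inner ℂ g (R p.1) := hR g p.1
    have h2 : inner ℂ (R g) p.2 = inner ℂ g (R p.2) := hR g p.2
    rw [map_add, inner_sub_left, inner_sub_right, inner_add_right, h1, h2]
    ring
  constructor
  · intro h
    rw [← Submodule.orthogonal_orthogonal N, Submodule.mem_orthogonal]
    intro g hg
    rw [← key]
    exact h _ _ ((hH _).2 (by simpa using hg))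
  · intro h a b hab
    obtain ⟨h1, h2⟩ := (hH _).1 hab
    have h3 := key (a + b)
    dsimp only at h1 h2
    rw [h1] at h3
    rw [show b = a + b - a by abel, h3]
    exact (Submodule.mem_orthogonal' _ _).1 h2 _ h

theorem mem_domain_adjoint_iff (hH : IsResolventRestriction R N H) [N.HasOrthogonalProjection]
    (hR : R.IsSymmetric) (hinj : ∀ f, R f ∈ N → f = 0) {f : E} :
    f ∈ H†.domain ↔ ∃ k ∈ N, ∃ g, f = k + R g := by
  rw [LinearPMap.mem_domain_iff]
  constructor
  · rintro ⟨h, hh⟩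
    exact ⟨_, (hH.mem_graph_adjoint_iff hR hinj _).1 hh, f + h, by simp⟩
  · rintro ⟨k, hk, g, rfl⟩
    exact ⟨g - (k + R g), (hH.mem_graph_adjoint_iff hR hinj _).2 (by simpa using hk)⟩

theorem le_adjoint (hH : IsResolventRestriction R N H) [N.HasOrthogonalProjection]
    (hR : R.IsSymmetric) (hinj : ∀ f, R f ∈ N → f = 0) : H ≤ H† := by
  rw [← LinearPMap.le_graph_iff]
  intro p hp
  rw [hH.mem_graph_adjoint_iff hR hinj, ((hH p).1 hp).1, sub_self]
  exact zero_mem _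

/-- For `N = ⊥` the graph of `H` and that of its adjoint are cut out by the same equation. -/
theorem isSelfAdjoint (hH : IsResolventRestriction R ⊥ H) (hR : R.IsSymmetric)
    (hinj : ∀ f, R f = 0 → f = 0) : IsSelfAdjoint H := by
  rw [LinearPMap.isSelfAdjoint_def]
  apply LinearPMap.eq_of_eq_graph
  ext p
  rw [hH.mem_graph_adjoint_iff hR (by simpa using hinj), hH p]
  simp [sub_eq_zero, eq_comm (a := p.1)]

/-- The number `z⁻¹` is not real, hence lies outside the spectrum of the self-adjoint `R`. -/
theorem isUnit_one_sub_smul (hR : R.IsSymmetric) {z : ℂ} (hz : z.im ≠ 0) :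
    IsUnit (1 - z • R) := by
  have hsa : IsSelfAdjoint R := ContinuousLinearMap.isSelfAdjoint_iff_isSymmetric.2 hR
  have hz0 : z ≠ 0 := by
    rintro rfl
    exact hz rfl
  have h : z⁻¹ ∉ spectrum ℂ R := by
    intro hmem
    have := hsa.im_eq_zero_of_mem_spectrum hmem
    rw [Complex.inv_im, div_eq_zero_iff, neg_eq_zero] at this
    simp [hz, hz0] at this
  rw [spectrum.notMem_iff] at h
  have h2 : (1 - z • R) = z • (algebraMap ℂ (E →L[ℂ] E) z⁻¹ - R) := by
    rw [smul_sub, Algebra.algebraMap_eq_smul_one, smul_smul, mul_inv_cancel₀ hz0, one_smul]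
  rw [h2]
  exact (IsUnit.smul (Units.mk0 z hz0) h)

theorem defectSubspace_eq (hH : IsResolventRestriction R N H) [N.HasOrthogonalProjection]
    (hR : R.IsSymmetric) (hinj : ∀ f, R f ∈ N → f = 0) (z : ℂ) :
    defectSubspace H z = N.comap (1 - (1 + z) • R : E →L[ℂ] E).toLinearMap := by
  ext f
  rw [defectSubspace, Submodule.mem_comap, hH.mem_graph_adjoint_iff hR hinj, Submodule.mem_comap]
  simp [add_smul]

/-- The invertible operator `1 - (1 + z) R` carries the defect space onto `N`, so all defect spaces
at nonreal `z` have the dimension of `N`. -/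
theorem exists_equiv_defectSubspace (hH : IsResolventRestriction R N H) [FiniteDimensional ℂ N]
    (hR : R.IsSymmetric) (hinj : ∀ f, R f ∈ N → f = 0) {z : ℂ} (hz : z.im ≠ 0) :
    Nonempty (N ≃ₗ[ℂ] defectSubspace H z) := by
  have hu : IsUnit (1 - (1 + z) • R) := isUnit_one_sub_smul hR (by simpa using hz)
  obtain ⟨u, hu⟩ := hu
  rw [hH.defectSubspace_eq hR hinj, ← hu]
  exact ⟨((ContinuousLinearEquiv.unitsEquiv ℂ E u).toLinearEquiv.ofSubmodule' N).symm⟩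

theorem nonempty_defectSubspace_equiv (hH : IsResolventRestriction R N H)
    [FiniteDimensional ℂ N] (hR : R.IsSymmetric) (hinj : ∀ f, R f ∈ N → f = 0) :
    Nonempty (defectSubspace H Complex.I ≃ₗᵢ[ℂ] defectSubspace H (-Complex.I)) := by
  obtain ⟨e₁⟩ := hH.exists_equiv_defectSubspace hR hinj (z := Complex.I) (by simp)
  obtain ⟨e₂⟩ := hH.exists_equiv_defectSubspace hR hinj (z := -Complex.I) (by simp)
  have := Module.Finite.equiv e₁
  have := Module.Finite.equiv e₂
  have h : Module.finrank ℂ (defectSubspace H Complex.I)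
      = Module.finrank ℂ (defectSubspace H (-Complex.I)) :=
    e₁.finrank_eq.symm.trans e₂.finrank_eq
  exact ⟨((stdOrthonormalBasis ℂ _).reindex (finCongr h)).equiv (stdOrthonormalBasis ℂ _)
    (Equiv.refl _)⟩

section Triplet

variable {K : Type*} [NormedAddCommGroup K] [InnerProductSpace ℂ K] [FiniteDimensional ℂ K]
variable {G : K →L[ℂ] E}

/-- The coefficient of the singular part is `G⁻¹ (f - R (f + H* f))`, which makes it linear in `f`.
-/
theorem exists_singularPart (hH : IsResolventRestriction R G.range H) (hR : R.IsSymmetric)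
    (hinj : ∀ f, R f ∈ G.range → f = 0) (hG : Function.Injective G) :
    ∃ κ : H†.domain →ₗ[ℂ] K, ∀ f : H†.domain, (f : E) = G (κ f) + R (f + H† f) := by
  let S : H†.domain →ₗ[ℂ] E :=
    H†.domain.subtype - R.toLinearMap ∘ₗ (H†.domain.subtype + H†.toFun)
  have hS : ∀ f : H†.domain, S f ∈ G.range := fun f =>
    (hH.mem_graph_adjoint_iff hR hinj (f, H† f)).1 (LinearPMap.mem_graph _ f)
  let e := LinearEquiv.ofInjective G.toLinearMap hG
  refine ⟨e.symm.toLinearMap ∘ₗ S.codRestrict G.range hS, fun f => ?_⟩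
  have h1 : G (e.symm (S.codRestrict G.range hS f)) = S f :=
    congrArg Subtype.val (e.apply_symm_apply (S.codRestrict G.range hS f))
  have h2 : S f = f - R (f + H† f) := rfl
  simp only [LinearMap.comp_apply, LinearEquiv.coe_coe, h1, h2, sub_add_cancel]

theorem surjective_adjoint (hG : Function.Injective G) :
    Function.Surjective (ContinuousLinearMap.adjoint G) := by
  have h : (ContinuousLinearMap.adjoint G).range = ⊤ := by
    rw [← Submodule.orthogonal_orthogonal (ContinuousLinearMap.adjoint G).range,
      ContinuousLinearMap.orthogonal_range, ContinuousLinearMap.adjoint_adjoint,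
      LinearMap.ker_eq_bot.2 hG, Submodule.bot_orthogonal_eq_top]
  exact LinearMap.range_eq_top.1 h

/-- Scaling `κ` by a real `c` and `G*` by `c⁻¹` leaves their pairing unchanged, and a symmetric `M`
drops out of Green's identity. -/
theorem isBoundaryTriplet (hH : IsResolventRestriction R G.range H) (hR : R.IsSymmetric)
    (hinj : ∀ f, R f ∈ G.range → f = 0) (hG : Function.Injective G)
    {M : K →ₗ[ℂ] K} (hM : M.IsSymmetric) {c : ℝ} (hc : c ≠ 0)
    {κ : H†.domain →ₗ[ℂ] K} (hκ : ∀ f : H†.domain, (f : E) = G (κ f) + R (f + H† f))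
    {Γ₀ Γ₁ : H†.domain →ₗ[ℂ] K} (h₀ : ∀ f, Γ₀ f = (c : ℂ) • κ f)
    (h₁ : ∀ f, Γ₁ f = (c : ℂ)⁻¹ • ContinuousLinearMap.adjoint G (f + H† f) + M (κ f)) :
    IsBoundaryTriplet H Γ₀ Γ₁ where
  dense := hH.dense_domain hR hinj
  closed := hH.isClosed
  symmetric := hH.le_adjoint hR hinj
  deficiency := hH.nonempty_defectSubspace_equiv hR hinj
  green f f' := by
    have hc' : (c : ℂ) ≠ 0 := by exact_mod_cast hc
    rw [h₀, h₀, h₁, h₁]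
    have hMs : inner ℂ (M (κ f')) (κ f) = inner ℂ (κ f') (M (κ f)) := hM _ _
    -- Adding the inner product of `f` and `f'` to both terms replaces `H†` by `1 + H†`, for which
    -- `hκ` is stated.
    have e1 : inner ℂ (f' : E) (H† f) - inner ℂ (H† f') (f : E)
        = inner ℂ (f' : E) (f + H† f) - inner ℂ (f' + H† f') (f : E) := by
      rw [inner_add_right, inner_add_left]
      ring
    have hRs : ∀ g h : E, inner ℂ (R g) h = inner ℂ g (R h) := hR
    have e2 : inner ℂ (f' : E) (f + H† f) = inner ℂ (κ f') (ContinuousLinearMap.adjoint G (f + H† f))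
        + inner ℂ (R (f' + H† f')) (f + H† f) := by
      rw [ContinuousLinearMap.adjoint_inner_right, ← inner_add_left, ← hκ f']
    have e3 : inner ℂ (f' + H† f') (f : E) =
        inner ℂ (ContinuousLinearMap.adjoint G (f' + H† f')) (κ f)
        + inner ℂ (f' + H† f') (R (f + H† f)) := by
      rw [ContinuousLinearMap.adjoint_inner_left, ← inner_add_right, ← hκ f]
    rw [e1, e2, e3, hRs]
    simp only [inner_smul_left, inner_smul_right, inner_add_left, inner_add_right, hMs,
      map_inv₀, Complex.conj_ofReal]
    field_simp
    ring
  surjective := by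
    rintro ⟨a, b⟩
    have hc' : (c : ℂ) ≠ 0 := by exact_mod_cast hc
    -- The singular coefficient must be `c⁻¹ a`; this value of `G* g` then solves the equation `Γ₁ f
    -- = b`.
    obtain ⟨g, hg⟩ := surjective_adjoint hG ((c : ℂ) • (b - M ((c : ℂ)⁻¹ • a)))
    let f : H†.domain := ⟨G ((c : ℂ)⁻¹ • a) + R g,
      (hH.mem_domain_adjoint_iff hR hinj).2 ⟨_, ⟨_, rfl⟩, g, rfl⟩⟩
    obtain ⟨e1, e2⟩ := singularPart_unique hinj hG ((hκ f).symm.trans (show (f : E) = _ from rfl))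
    refine ⟨f, ?_⟩
    simp only [h₀, h₁, e1, e2, hg, smul_smul, mul_inv_cancel₀ hc', inv_mul_cancel₀ hc', one_smul,
      sub_add_cancel]

theorem adjointRestrictKer (hH : IsResolventRestriction R G.range H) (hR : R.IsSymmetric)
    (hinj : ∀ f, R f ∈ G.range → f = 0) (hG : Function.Injective G)
    {κ : H†.domain →ₗ[ℂ] K} (hκ : ∀ f : H†.domain, (f : E) = G (κ f) + R (f + H† f))
    {Γ₀ : H†.domain →ₗ[ℂ] K} (h₀ : ∀ f, Γ₀ f = 0 ↔ κ f = 0) :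
    IsResolventRestriction R ⊥ (PointInteraction.adjointRestrictKer H Γ₀) := by
  intro p
  rw [Submodule.bot_orthogonal_eq_top, and_iff_left Submodule.mem_top, LinearPMap.mem_graph_iff]
  constructor
  · rintro ⟨y, hy, hy'⟩
    obtain ⟨f, hf, hfy⟩ := y.2.1
    have h1 : PointInteraction.adjointRestrictKer H Γ₀ y = H† f :=
      LinearPMap.domRestrict_apply hfy.symm
    have h2 := hκ f
    rw [(h₀ f).1 hf, map_zero, zero_add] at h2
    rw [← hy', ← hy, h1, ← hfy]
    exact h2.symm
  · intro hp
    have hg : p ∈ H†.graph := by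
      rw [hH.mem_graph_adjoint_iff hR hinj, hp, sub_self]
      exact zero_mem _
    obtain ⟨f, hf, hf'⟩ := (LinearPMap.mem_graph_iff _).1 hg
    have h1 : G (κ f) + R (f + H† f) = G 0 + R (f + H† f) := by
      rw [← hκ f, map_zero, zero_add, hf, hf', hp]
    have h2 : Γ₀ f = 0 := (h₀ f).2 (singularPart_unique hinj hG h1).1
    refine ⟨⟨f, ⟨⟨f, h2, rfl⟩, f.2⟩⟩, hf, ?_⟩
    rw [← hf']
    exact LinearPMap.domRestrict_apply rfl

end Triplet

end IsResolventRestriction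

end Abstract

/-! ### Two subordination integrals -/

/-- The primitives used below contain `r / (2 * √t)`, whose value at `t = 0` is not the right-hand
limit; hence only a one-sided limit at `a` is assumed. -/
theorem integral_Ioi_of_hasDerivAt_of_nonneg_of_tendsto {g g' : ℝ → ℝ} {a l₀ l : ℝ}
    (hderiv : ∀ t ∈ Set.Ioi a, HasDerivAt g (g' t) t) (hpos : ∀ t ∈ Set.Ioi a, 0 ≤ g' t)
    (h₀ : Tendsto g (𝓝[>] a) (𝓝 l₀)) (h : Tendsto g atTop (𝓝 l)) :
    ∫ t in Set.Ioi a, g' t = l - l₀ := by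
  have heq : ∀ t ∈ Set.Ioi a, Function.update g a l₀ =ᶠ[𝓝 t] g := fun t ht => by
    filter_upwards [Ioi_mem_nhds ht] with s hs
    exact Function.update_of_ne (ne_of_gt hs) _ _
  have h1 : ContinuousWithinAt (Function.update g a l₀) (Set.Ici a) a := by
    rw [continuousWithinAt_update_same]
    simpa using h₀
  have h2 : Tendsto (Function.update g a l₀) atTop (𝓝 l) := by
    refine h.congr' ?_
    filter_upwards [Ioi_mem_atTop a] with s hs
    exact (Function.update_of_ne (ne_of_gt hs) _ _).symm
  have := integral_Ioi_of_hasDerivAt_of_nonneg h1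
    (fun t ht => (hderiv t ht).congr_of_eventuallyEq (heq t ht)) hpos h2
  simpa using this

/-- The unnormalized error function. -/
noncomputable def gaussPrimitive (z : ℝ) : ℝ := ∫ s in (0 : ℝ)..z, Real.exp (-s ^ 2)

theorem hasDerivAt_gaussPrimitive (z : ℝ) :
    HasDerivAt gaussPrimitive (Real.exp (-z ^ 2)) z := by
  have hc : Continuous fun s : ℝ => Real.exp (-s ^ 2) := by fun_prop
  exact intervalIntegral.integral_hasDerivAt_right (hc.intervalIntegrable _ _)
    hc.stronglyMeasurable.stronglyMeasurableAtFilter hc.continuousAt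

theorem tendsto_gaussPrimitive_atTop :
    Tendsto gaussPrimitive atTop (𝓝 (√Real.pi / 2)) := by
  have h := intervalIntegral_tendsto_integral_Ioi (f := fun s : ℝ => Real.exp (-1 * s ^ 2)) 0
    (integrable_exp_neg_mul_sq one_pos).integrableOn tendsto_id
  rw [integral_gaussian_Ioi] at h
  simp only [neg_mul, one_mul, div_one] at h
  exact h

theorem gaussPrimitive_neg (z : ℝ) : gaussPrimitive (-z) = -gaussPrimitive z := by
  have h := intervalIntegral.integral_comp_neg (a := z) (b := 0) fun s : ℝ => Real.exp (-s ^ 2)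
  simp only [neg_zero, even_two, Even.neg_pow] at h
  rw [gaussPrimitive, gaussPrimitive, ← h, intervalIntegral.integral_symm]

theorem tendsto_gaussPrimitive_atBot :
    Tendsto gaussPrimitive atBot (𝓝 (-(√Real.pi / 2))) := by
  have h := (tendsto_gaussPrimitive_atTop.comp tendsto_neg_atBot_atTop).neg
  refine h.congr fun z => ?_
  simp [gaussPrimitive_neg]

/-- Since `(r/(2√t) + ε√t)² = r²/(4t) + εr + t`, the factor `e^{εr}` cancels the cross term. Adding
the cases `ε = ±1` isolates the `t^{-3/2}` term, subtracting them the `t^{-1/2}` term. -/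
theorem hasDerivAt_gaussPrimitive_comp (r : ℝ) (ε : ℝ) (hε : ε ^ 2 = 1) {t : ℝ} (ht : 0 < t) :
    HasDerivAt (fun t => Real.exp (ε * r) * gaussPrimitive (r / (2 * √t) + ε * √t))
      (Real.exp (-(r ^ 2 / (4 * t)) - t) * (-(r / 4) * (t * √t)⁻¹ + ε / 2 * (√t)⁻¹)) t := by
  have hs : 0 < √t := Real.sqrt_pos.2 ht
  have hss : √t ^ 2 = t := Real.sq_sqrt ht.le
  have h1 := Real.hasDerivAt_sqrt ht.ne'
  have h2 := ((h1.const_mul 2).fun_inv (by positivity)).const_mul r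
  have h3 := h2.add (h1.const_mul ε)
  have h4 := ((hasDerivAt_gaussPrimitive _).comp t h3).const_mul (Real.exp (ε * r))
  refine h4.congr_deriv ?_ |>.congr_of_eventuallyEq (Eventually.of_forall fun s => ?_)
  · have he : Real.exp (ε * r) * Real.exp (-(r * (2 * √t)⁻¹ + ε * √t) ^ 2)
        = Real.exp (-(r ^ 2 / (4 * t)) - t) := by
      rw [← Real.exp_add]
      congr 1
      have : (r * (2 * √t)⁻¹ + ε * √t) ^ 2 = r ^ 2 / (4 * √t ^ 2) + ε * r + ε ^ 2 * √t ^ 2 := by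
        field_simp
        ring
      rw [this, hε, hss]
      ring
    simp only [Pi.add_apply]
    rw [← mul_assoc, he]
    congr 1
    rw [show t * √t = √t ^ 2 * √t by rw [hss]]
    field_simp
    ring
  · simp [Function.comp, div_eq_mul_inv]

theorem tendsto_arg_nhdsGT {r : ℝ} (hr : 0 < r) (ε : ℝ) :
    Tendsto (fun t => r / (2 * √t) + ε * √t) (𝓝[>] 0) atTop := by
  have h1 : Tendsto (fun t : ℝ => √t) (𝓝[>] 0) (𝓝[>] 0) := by
    refine tendsto_nhdsWithin_iff.2 ⟨?_, ?_⟩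
    · have := (Real.continuous_sqrt.tendsto 0).mono_left (nhdsWithin_le_nhds (s := Set.Ioi 0))
      simpa using this
    · filter_upwards [self_mem_nhdsWithin] with t ht using Real.sqrt_pos.2 ht
  have h2 : Tendsto (fun t : ℝ => r / 2 * (√t)⁻¹) (𝓝[>] 0) atTop :=
    (tendsto_inv_nhdsGT_zero.comp h1).const_mul_atTop (by positivity)
  have h3 : Tendsto (fun t : ℝ => ε * √t) (𝓝[>] 0) (𝓝 (ε * 0)) :=
    (tendsto_nhds_of_tendsto_nhdsWithin h1).const_mul ε
  refine (h2.atTop_add h3).congr fun t => ?_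
  rw [div_mul_eq_div_div, div_eq_mul_inv (r / 2)]

theorem tendsto_arg_pos_atTop (r : ℝ) :
    Tendsto (fun t => r / (2 * √t) + 1 * √t) atTop atTop := by
  have h1 : Tendsto (fun t : ℝ => r / (2 * √t)) atTop (𝓝 0) :=
    (Real.tendsto_sqrt_atTop.const_mul_atTop two_pos).const_div_atTop r
  simpa using h1.add_atTop Real.tendsto_sqrt_atTop

theorem tendsto_arg_neg_atTop (r : ℝ) :
    Tendsto (fun t => r / (2 * √t) + (-1) * √t) atTop atBot := by
  have h1 : Tendsto (fun t : ℝ => r / (2 * √t)) atTop (𝓝 0) :=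
    (Real.tendsto_sqrt_atTop.const_mul_atTop two_pos).const_div_atTop r
  simpa using h1.add_atBot (tendsto_neg_atTop_atBot.comp Real.tendsto_sqrt_atTop)

theorem integral_inv_sqrt_cubed_mul_exp {r : ℝ} (hr : 0 < r) :
    ∫ t in Set.Ioi (0 : ℝ), (t * √t)⁻¹ * Real.exp (-(r ^ 2 / (4 * t)) - t)
      = 2 * √Real.pi * (Real.exp (-r) / r) := by
  have h := integral_Ioi_of_hasDerivAt_of_nonneg_of_tendsto (a := 0)
    (g := fun t => -(2 / r) * (Real.exp (-1 * r) * gaussPrimitive (r / (2 * √t) + (-1) * √t)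
      + Real.exp (1 * r) * gaussPrimitive (r / (2 * √t) + 1 * √t)))
    (g' := fun t => (t * √t)⁻¹ * Real.exp (-(r ^ 2 / (4 * t)) - t))
    (fun t ht => (((hasDerivAt_gaussPrimitive_comp r (-1) (by norm_num) ht).add
      (hasDerivAt_gaussPrimitive_comp r 1 (by norm_num) ht)).const_mul _).congr_deriv
        (by field_simp; ring))
    (fun t ht => by have : 0 < t := ht; positivity)
    ((((tendsto_gaussPrimitive_atTop.comp (tendsto_arg_nhdsGT hr (-1))).const_mul _).add
      ((tendsto_gaussPrimitive_atTop.comp (tendsto_arg_nhdsGT hr 1)).const_mul _)).const_mul _)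
    ((((tendsto_gaussPrimitive_atBot.comp (tendsto_arg_neg_atTop r)).const_mul _).add
      ((tendsto_gaussPrimitive_atTop.comp (tendsto_arg_pos_atTop r)).const_mul _)).const_mul _)
  rw [h, neg_one_mul]
  field_simp
  ring

theorem integral_inv_sqrt_mul_exp {r : ℝ} (hr : 0 < r) :
    ∫ t in Set.Ioi (0 : ℝ), (√t)⁻¹ * Real.exp (-(r ^ 2 / (4 * t)) - t)
      = √Real.pi * Real.exp (-r) := by
  have h := integral_Ioi_of_hasDerivAt_of_nonneg_of_tendsto (a := 0)
    (g := fun t => Real.exp (1 * r) * gaussPrimitive (r / (2 * √t) + 1 * √t)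
      - Real.exp (-1 * r) * gaussPrimitive (r / (2 * √t) + (-1) * √t))
    (g' := fun t => (√t)⁻¹ * Real.exp (-(r ^ 2 / (4 * t)) - t))
    (fun t ht => ((hasDerivAt_gaussPrimitive_comp r 1 (by norm_num) ht).sub
      (hasDerivAt_gaussPrimitive_comp r (-1) (by norm_num) ht)).congr_deriv
        (by ring))
    (fun t ht => by have : 0 < t := ht; positivity)
    (((tendsto_gaussPrimitive_atTop.comp (tendsto_arg_nhdsGT hr 1)).const_mul _).sub
      ((tendsto_gaussPrimitive_atTop.comp (tendsto_arg_nhdsGT hr (-1))).const_mul _))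
    (((tendsto_gaussPrimitive_atTop.comp (tendsto_arg_pos_atTop r)).const_mul _).sub
      ((tendsto_gaussPrimitive_atBot.comp (tendsto_arg_neg_atTop r)).const_mul _))
  rw [h, neg_one_mul]
  ring

/-! ### Fourier transforms of `e^{-|v|} / |v|` and `e^{-|v|}` -/

open scoped FourierTransform RealInnerProductSpace

/-- The damped heat kernel `t^{p - 3/2} e^{-|v|²/4t - t}`. -/
noncomputable def heat (p : ℕ) (t : ℝ) (v : R3) : ℝ :=
  t ^ p * (t * √t)⁻¹ * Real.exp (-(‖v‖ ^ 2 / (4 * t)) - t)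

theorem measurable_heat (p : ℕ) : Measurable (Function.uncurry (heat p)) := by
  unfold heat Function.uncurry
  fun_prop

theorem heat_nonneg (p : ℕ) {t : ℝ} (ht : 0 < t) (v : R3) : 0 ≤ heat p t v := by
  unfold heat
  positivity

theorem heat_eq (p : ℕ) (t : ℝ) (v : R3) :
    heat p t v = t ^ p * (t * √t)⁻¹ * Real.exp (-t) * Real.exp (-(4 * t)⁻¹ * ‖v‖ ^ 2) := by
  rw [heat, mul_assoc _ (Real.exp _), ← Real.exp_add]
  congr 2
  rw [div_eq_inv_mul]
  ring

theorem rpow_gaussian_factor {t : ℝ} (ht : 0 < t) :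
    (Real.pi / (4 * t)⁻¹) ^ ((Module.finrank ℝ R3 : ℝ) / 2)
      = 8 * Real.pi * √Real.pi * (t * √t) := by
  have h0 : (0 : ℝ) < Real.pi / (4 * t)⁻¹ := by positivity
  have h1 : ((Module.finrank ℝ R3 : ℝ) / 2) = 1 + 1 / 2 := by
    rw [finrank_euclideanSpace_fin]
    norm_num
  rw [h1, Real.rpow_add h0, Real.rpow_one, ← Real.sqrt_eq_rpow, div_inv_eq_mul,
    Real.sqrt_mul Real.pi_pos.le, Real.sqrt_mul (by norm_num), show (4 : ℝ) = 2 ^ 2 by norm_num,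
    Real.sqrt_sq (by norm_num)]
  ring

theorem integral_heat (p : ℕ) {t : ℝ} (ht : 0 < t) :
    ∫ v, heat p t v = 8 * Real.pi * √Real.pi * (t ^ p * Real.exp (-t)) := by
  simp_rw [heat_eq]
  rw [integral_const_mul, GaussianFourier.integral_rexp_neg_mul_sq_norm (by positivity),
    rpow_gaussian_factor ht]
  have : 0 < √t := Real.sqrt_pos.2 ht
  field_simp

theorem integrable_heat (p : ℕ) {t : ℝ} (ht : 0 < t) : Integrable (heat p t) := by
  -- The Bochner integral of a non-integrable function is `0`, so the nonzero value proves
  -- integrability.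
  refine Integrable.of_integral_ne_zero ?_
  rw [integral_heat p ht]
  positivity

theorem integral_fourierChar_smul_heat (p : ℕ) {t : ℝ} (ht : 0 < t) (w : R3) :
    ∫ v : R3, Real.fourierChar (-⟪v, w⟫) • (heat p t v : ℂ)
      = ((8 * Real.pi * √Real.pi *
        (t ^ p * Real.exp (-((1 + 4 * Real.pi ^ 2 * ‖w‖ ^ 2) * t))) : ℝ) : ℂ) := by
  have hb : 0 < (((4 * t)⁻¹ : ℝ) : ℂ).re := by
    rw [Complex.ofReal_re]
    positivity
  have h := fourier_gaussian_innerProductSpace hb w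
  rw [Real.fourier_eq] at h
  have h1 : ∀ v : R3, Real.fourierChar (-⟪v, w⟫) • (heat p t v : ℂ)
      = ((t ^ p * (t * √t)⁻¹ * Real.exp (-t) : ℝ) : ℂ) *
        (Real.fourierChar (-⟪v, w⟫) • Complex.exp (-((4 * t)⁻¹ : ℝ) * (‖v‖ : ℂ) ^ 2)) := by
    intro v
    rw [heat_eq, mul_smul_comm]
    push_cast
    rfl
  simp_rw [h1]
  rw [integral_const_mul, h]
  have h2 : ((Real.pi : ℂ) / ((4 * t)⁻¹ : ℝ)) ^ ((Module.finrank ℝ R3 : ℂ) / 2)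
      = ((8 * Real.pi * √Real.pi * (t * √t) : ℝ) : ℂ) := by
    rw [← rpow_gaussian_factor ht, Complex.ofReal_cpow (by positivity)]
    push_cast
    rfl
  have h3 : Complex.exp (-(Real.pi : ℂ) ^ 2 * (‖w‖ : ℂ) ^ 2 / ((4 * t)⁻¹ : ℝ))
      = ((Real.exp (-(4 * Real.pi ^ 2 * ‖w‖ ^ 2 * t)) : ℝ) : ℂ) := by
    push_cast
    congr 1
    rw [div_inv_eq_mul]
    ring
  rw [h2, h3, ← Complex.ofReal_mul, ← Complex.ofReal_mul]
  congr 1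
  have : 0 < √t := Real.sqrt_pos.2 ht
  rw [show -((1 + 4 * Real.pi ^ 2 * ‖w‖ ^ 2) * t) = -t + -(4 * Real.pi ^ 2 * ‖w‖ ^ 2 * t) by ring,
    Real.exp_add]
  field_simp

theorem integrable_pow_mul_exp_neg (p : ℕ) :
    IntegrableOn (fun t : ℝ => t ^ p * Real.exp (-t)) (Set.Ioi 0) := by
  refine (Real.GammaIntegral_convergent (s := p + 1) (by positivity)).congr_fun
    (fun t _ => ?_) measurableSet_Ioi
  simp [mul_comm]

theorem integral_pow_mul_exp_neg_mul (p : ℕ) {s : ℝ} (hs : 0 < s) :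
    ∫ t in Set.Ioi (0 : ℝ), t ^ p * Real.exp (-(s * t)) = s⁻¹ ^ (p + 1) * p.factorial := by
  have h := Real.integral_rpow_mul_exp_neg_mul_Ioi (a := p + 1) (by positivity) hs
  rw [Real.Gamma_nat_eq_factorial, one_div] at h
  rw [← Real.rpow_natCast s⁻¹ (p + 1)]
  push_cast
  rw [← h]
  simp

theorem integrable_prod_heat (p : ℕ) :
    Integrable (Function.uncurry (heat p)) ((volume.restrict (Set.Ioi (0 : ℝ))).prod volume) := by
  rw [integrable_prod_iff (measurable_heat p).aestronglyMeasurable]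
  refine ⟨(ae_restrict_iff' measurableSet_Ioi).2 (Eventually.of_forall fun t ht =>
    integrable_heat p ht), ?_⟩
  refine IntegrableOn.congr_fun ((integrable_pow_mul_exp_neg p).const_mul
    (8 * Real.pi * √Real.pi)) (fun t ht => ?_) measurableSet_Ioi
  simp only [Function.uncurry]
  rw [← integral_heat p ht]
  exact integral_congr_ae (Eventually.of_forall fun v =>
    (Real.norm_of_nonneg (heat_nonneg p ht v)).symm)

/-- The symbol `1 / (1 + 4π²|w|²)` of the resolvent `(1 - Δ)⁻¹`. -/
noncomputable def resolventSymbol (w : R3) : ℝ := (1 + 4 * Real.pi ^ 2 * ‖w‖ ^ 2)⁻¹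

theorem integrable_integral_heat (p : ℕ) :
    Integrable fun v : R3 => ∫ t in Set.Ioi (0 : ℝ), heat p t v :=
  (integrable_prod_heat p).integral_prod_right

/-- After Fubini, the transformed Gaussian leaves the Laplace integral of `t ^ p` at `1 + 4π²|w|²`,
hence the power `p + 1` of the symbol. -/
theorem fourier_integral_heat (p : ℕ) (w : R3) :
    𝓕 (fun v : R3 => ((∫ t in Set.Ioi (0 : ℝ), heat p t v : ℝ) : ℂ)) w
      = ((8 * Real.pi * √Real.pi * (resolventSymbol w ^ (p + 1) * p.factorial) : ℝ) : ℂ) := by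
  have hint : Integrable (Function.uncurry fun (t : ℝ) (v : R3) =>
      Real.fourierChar (-⟪v, w⟫) • (heat p t v : ℂ))
      ((volume.restrict (Set.Ioi (0 : ℝ))).prod volume) := by
    refine (integrable_prod_heat p).mono (Measurable.aestronglyMeasurable ?_)
      (Eventually.of_forall fun q => ?_)
    · have h1 : Measurable fun q : ℝ × R3 => (Real.fourierChar (-⟪q.2, w⟫) : ℂ) :=
        Continuous.measurable (by fun_prop)
      exact h1.mul (Complex.measurable_ofReal.comp (measurable_heat p))
    · simp [Function.uncurry, Circle.norm_smul]
  rw [Real.fourier_eq]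
  calc ∫ v : R3, Real.fourierChar (-⟪v, w⟫) • ((∫ t in Set.Ioi (0 : ℝ), heat p t v : ℝ) : ℂ)
      = ∫ v : R3, ∫ t in Set.Ioi (0 : ℝ), Real.fourierChar (-⟪v, w⟫) • (heat p t v : ℂ) := by
        congr 1
        ext v
        simp only [Circle.smul_def]
        rw [← integral_complex_ofReal, integral_smul]
    _ = ∫ t in Set.Ioi (0 : ℝ), ∫ v : R3, Real.fourierChar (-⟪v, w⟫) • (heat p t v : ℂ) :=
        (integral_integral_swap hint).symm
    _ = ∫ t in Set.Ioi (0 : ℝ), ((8 * Real.pi * √Real.pi *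
        (t ^ p * Real.exp (-((1 + 4 * Real.pi ^ 2 * ‖w‖ ^ 2) * t))) : ℝ) : ℂ) :=
        setIntegral_congr_fun measurableSet_Ioi fun t ht => integral_fourierChar_smul_heat p ht w
    _ = _ := by
        rw [integral_complex_ofReal, integral_const_mul, integral_pow_mul_exp_neg_mul p (by positivity)]
        rfl

theorem integral_heat_zero {v : R3} (hv : v ≠ 0) :
    ∫ t in Set.Ioi (0 : ℝ), heat 0 t v = 2 * √Real.pi * (Real.exp (-‖v‖) / ‖v‖) := by
  rw [← integral_inv_sqrt_cubed_mul_exp (norm_pos_iff.2 hv)]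
  simp [heat]

theorem integral_heat_one {v : R3} (hv : v ≠ 0) :
    ∫ t in Set.Ioi (0 : ℝ), heat 1 t v = √Real.pi * Real.exp (-‖v‖) := by
  rw [← integral_inv_sqrt_mul_exp (norm_pos_iff.2 hv)]
  refine setIntegral_congr_fun measurableSet_Ioi fun t ht => ?_
  have : t ≠ 0 := ne_of_gt ht
  simp only [heat, pow_one, mul_inv, ← mul_assoc, mul_inv_cancel₀ this, one_mul]

theorem ae_ne_zero : ∀ᵐ v : R3, v ≠ 0 := by
  simp [ae_iff, measure_singleton]

theorem fourier_congr_ae {F : Type*} [NormedAddCommGroup F] [NormedSpace ℂ F] {f g : R3 → F}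
    (h : f =ᵐ[volume] g) (w : R3) : 𝓕 f w = 𝓕 g w := by
  rw [Real.fourier_eq, Real.fourier_eq]
  refine integral_congr_ae ?_
  filter_upwards [h] with v hv
  rw [hv]

theorem fourier_const_mul (c : ℂ) (f : R3 → ℂ) (w : R3) :
    𝓕 (fun v => c * f v) w = c * 𝓕 f w := by
  rw [Real.fourier_eq, Real.fourier_eq, ← integral_const_mul]
  simp_rw [mul_smul_comm]

theorem fourier_exp_div (w : R3) :
    𝓕 (fun v : R3 => ((Real.exp (-‖v‖) / ‖v‖ : ℝ) : ℂ)) w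
      = ((4 * Real.pi * resolventSymbol w : ℝ) : ℂ) := by
  have hpi : 0 < √Real.pi := Real.sqrt_pos.2 Real.pi_pos
  have h : (fun v : R3 => ((Real.exp (-‖v‖) / ‖v‖ : ℝ) : ℂ)) =ᵐ[volume]
      fun v => (((2 * √Real.pi)⁻¹ : ℝ) : ℂ) * ((∫ t in Set.Ioi (0 : ℝ), heat 0 t v : ℝ) : ℂ) := by
    filter_upwards [ae_ne_zero] with v hv
    rw [integral_heat_zero hv, ← Complex.ofReal_mul, inv_mul_cancel_left₀ (by positivity)]
  rw [fourier_congr_ae h, fourier_const_mul, fourier_integral_heat, ← Complex.ofReal_mul]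
  congr 1
  simp only [zero_add, pow_one, Nat.factorial_zero, Nat.cast_one]
  field_simp
  ring

theorem fourier_exp (w : R3) :
    𝓕 (fun v : R3 => ((Real.exp (-‖v‖) : ℝ) : ℂ)) w
      = ((8 * Real.pi * resolventSymbol w ^ 2 : ℝ) : ℂ) := by
  have hpi : 0 < √Real.pi := Real.sqrt_pos.2 Real.pi_pos
  have h : (fun v : R3 => ((Real.exp (-‖v‖) : ℝ) : ℂ)) =ᵐ[volume]
      fun v => (((√Real.pi)⁻¹ : ℝ) : ℂ) * ((∫ t in Set.Ioi (0 : ℝ), heat 1 t v : ℝ) : ℂ) := by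
    filter_upwards [ae_ne_zero] with v hv
    rw [integral_heat_one hv, ← Complex.ofReal_mul, inv_mul_cancel_left₀ (by positivity)]
  rw [fourier_congr_ae h, fourier_const_mul, fourier_integral_heat, ← Complex.ofReal_mul]
  congr 1
  simp only [one_add_one_eq_two, Nat.factorial_one, Nat.cast_one]
  field_simp

theorem integrable_exp_div : Integrable fun v : R3 => Real.exp (-‖v‖) / ‖v‖ := by
  refine ((integrable_integral_heat 0).const_mul (2 * √Real.pi)⁻¹).congr ?_
  filter_upwards [ae_ne_zero] with v hv
  have : 0 < √Real.pi := Real.sqrt_pos.2 Real.pi_pos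
  rw [integral_heat_zero hv]
  field_simp

theorem integrable_exp : Integrable fun v : R3 => Real.exp (-‖v‖) := by
  refine ((integrable_integral_heat 1).const_mul (√Real.pi)⁻¹).congr ?_
  filter_upwards [ae_ne_zero] with v hv
  have : 0 < √Real.pi := Real.sqrt_pos.2 Real.pi_pos
  rw [integral_heat_one hv]
  field_simp

/-! ### The Fourier transform on `L¹ ∩ L²` -/

theorem ae_eq_of_toDist_apply_eq {n : ℕ} {f : L2 n} {u : R3 → Cn n} (hu : Continuous u)
    (h : ∀ g : 𝓢(R3, ℂ), toDist n f g = ∫ y, g y • u y) : (f : R3 → Cn n) =ᵐ[volume] u := by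
  refine ae_eq_of_integral_contDiff_smul_eq ((Lp.memLp f).locallyIntegrable one_le_two)
    hu.locallyIntegrable fun g hg hgc => ?_
  have hg₁ : HasCompactSupport (Complex.ofRealCLM ∘ g) := hgc.comp_left rfl
  have hg₂ := Complex.ofRealCLM.contDiff.comp hg
  have := h (hg₁.toSchwartzMap hg₂)
  simpa using this

theorem continuous_fourier {F : Type*} [NormedAddCommGroup F] [NormedSpace ℂ F] {f : R3 → F}
    (hf : Integrable f) : Continuous (𝓕 f) :=
  VectorFourier.fourierIntegral_continuous Real.continuous_fourierChar
    (by exact continuous_inner) hf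

theorem continuous_fourierInv {F : Type*} [NormedAddCommGroup F] [NormedSpace ℂ F] {f : R3 → F}
    (hf : Integrable f) : Continuous (𝓕⁻ f) := by
  have h : 𝓕⁻ f = fun w => 𝓕 f (-w) := funext fun w => Real.fourierInv_eq_fourier_neg f w
  rw [h]
  exact (continuous_fourier hf).comp continuous_neg

/-- Both sides define the same tempered distribution: in each case the transform can be moved onto
the test function. -/
theorem fourier_toLp_ae_eq {n : ℕ} {f : R3 → Cn n} (h₁ : Integrable f) (h₂ : MemLp f 2 volume) :
    ((𝓕 (h₂.toLp f) : L2 n) : R3 → Cn n) =ᵐ[volume] 𝓕 f := by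
  refine ae_eq_of_toDist_apply_eq (continuous_fourier h₁) fun g => ?_
  have h : toDist n (𝓕 (h₂.toLp f)) = 𝓕 (toDist n (h₂.toLp f)) :=
    (Lp.fourier_toTemperedDistribution_eq _).symm
  rw [h, TemperedDistribution.fourier_apply, Lp.toTemperedDistributionCLM_apply,
    Lp.toTemperedDistribution_apply]
  have h' := VectorFourier.integral_fourierIntegral_smul_eq_flip (L := innerₗ R3)
    Real.continuous_fourierChar continuous_inner (g.integrable (μ := volume)) h₁
  rw [flip_innerₗ] at h'
  refine Eq.trans (integral_congr_ae ?_) h'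
  filter_upwards [h₂.coeFn_toLp] with y hy
  rw [hy]
  rfl

theorem fourierInv_toLp_ae_eq {n : ℕ} {f : R3 → Cn n} (h₁ : Integrable f)
    (h₂ : MemLp f 2 volume) :
    ((𝓕⁻ (h₂.toLp f) : L2 n) : R3 → Cn n) =ᵐ[volume] 𝓕⁻ f := by
  refine ae_eq_of_toDist_apply_eq (continuous_fourierInv h₁) fun g => ?_
  have h : toDist n (𝓕⁻ (h₂.toLp f)) = 𝓕⁻ (toDist n (h₂.toLp f)) :=
    (Lp.fourierInv_toTemperedDistribution_eq _).symm
  rw [h, TemperedDistribution.fourierInv_apply, Lp.toTemperedDistributionCLM_apply,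
    Lp.toTemperedDistribution_apply]
  have hL : (-innerₗ R3).flip = -innerₗ R3 := by
    ext v w
    simp [real_inner_comm]
  have h' := VectorFourier.integral_fourierIntegral_smul_eq_flip (L := -innerₗ R3)
    Real.continuous_fourierChar (continuous_inner (𝕜 := ℝ) (E := R3)).neg
    (g.integrable (μ := volume)) h₁
  rw [hL] at h'
  refine Eq.trans (integral_congr_ae ?_) h'
  filter_upwards [h₂.coeFn_toLp] with y hy
  rw [hy, SchwartzMap.fourierInv_coe]
  rfl

/-! ### The resolvent `(1 - Δ)⁻¹` -/

theorem resolventSymbol_pos (w : R3) : 0 < resolventSymbol w := by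
  unfold resolventSymbol
  positivity

theorem one_add_norm_sq_mul_resolventSymbol_le (w : R3) :
    (1 + ‖w‖ ^ 2) * resolventSymbol w ≤ 1 := by
  rw [resolventSymbol, mul_inv_le_iff₀ (by positivity)]
  nlinarith [sq_nonneg ‖w‖, Real.pi_gt_three, mul_nonneg (sq_nonneg ‖w‖) (sq_nonneg (Real.pi - 1))]

theorem resolventSymbol_le_one (w : R3) : resolventSymbol w ≤ 1 := by
  nlinarith [one_add_norm_sq_mul_resolventSymbol_le w, resolventSymbol_pos w,
    mul_nonneg (sq_nonneg ‖w‖) (resolventSymbol_pos w).le]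

theorem hasTemperateGrowth_resolventSymbol : resolventSymbol.HasTemperateGrowth := by
  have h1 : (fun w : R3 => (2 * Real.pi) • w).HasTemperateGrowth :=
    ((2 * Real.pi) • ContinuousLinearMap.id ℝ R3).hasTemperateGrowth
  have h2 := (Function.hasTemperateGrowth_one_add_norm_sq_rpow R3 (-1)).comp h1
  convert! h2 using 1
  ext w
  simp only [Function.comp, resolventSymbol, norm_smul, Real.rpow_neg_one]
  rw [Real.norm_of_nonneg (by positivity)]
  ring

theorem continuous_resolventSymbol : Continuous resolventSymbol :=
  hasTemperateGrowth_resolventSymbol.1.continuous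

theorem hasTemperateGrowth_ofReal_resolventSymbol :
    (fun w : R3 => (resolventSymbol w : ℂ)).HasTemperateGrowth :=
  Complex.ofRealCLM.hasTemperateGrowth.comp hasTemperateGrowth_resolventSymbol

/-- The square decays like `|w|⁻⁴`, integrable in dimension three. This is what makes functions in
the range of the resolvent continuous. -/
theorem memLp_two_resolventSymbol : MemLp (fun w : R3 => (resolventSymbol w : ℂ)) 2 volume := by
  refine MemLp.ofReal (f := resolventSymbol) ?_
  rw [memLp_two_iff_integrable_sq continuous_resolventSymbol.aestronglyMeasurable]
  have h : Integrable (fun w : R3 => (1 + ‖w‖ ^ 2) ^ (-(4 : ℝ) / 2)) volume :=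
    integrable_rpow_neg_one_add_norm_sq (by rw [finrank_euclideanSpace_fin]; norm_num)
  refine h.mono' (continuous_resolventSymbol.pow 2).aestronglyMeasurable
    (Eventually.of_forall fun w => ?_)
  have h0 := resolventSymbol_pos w
  rw [Real.norm_of_nonneg (by positivity), show -(4 : ℝ) / 2 = -(2 : ℕ) by norm_num,
    Real.rpow_neg (by positivity), Real.rpow_natCast, ← inv_pow]
  refine pow_le_pow_left₀ h0.le ?_ 2
  rw [← one_div, le_div_iff₀' (by positivity)]
  exact one_add_norm_sq_mul_resolventSymbol_le w

theorem memLp_top_resolventSymbol : MemLp (fun w : R3 => (resolventSymbol w : ℂ)) ⊤ volume := by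
  refine memLp_top_of_bound (Complex.continuous_ofReal.comp
    continuous_resolventSymbol).aestronglyMeasurable 1 (Eventually.of_forall fun w => ?_)
  rw [Complex.norm_real, Real.norm_of_nonneg (resolventSymbol_pos w).le]
  exact resolventSymbol_le_one w

/-- Multiplication by the symbol of the resolvent. -/
noncomputable def mulResolventSymbol (n : ℕ) : L2 n →L[ℂ] L2 n :=
  (ContinuousLinearMap.lsmul ℂ ℂ).holderL volume ⊤ 2 2 (memLp_top_resolventSymbol.toLp _)

theorem coeFn_mulResolventSymbol {n : ℕ} (f : L2 n) :
    (mulResolventSymbol n f : R3 → Cn n) =ᵐ[volume] fun w => (resolventSymbol w : ℂ) • f w := by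
  filter_upwards [(ContinuousLinearMap.lsmul ℂ ℂ).coeFn_holder (r := 2)
    (memLp_top_resolventSymbol.toLp _) f, memLp_top_resolventSymbol.coeFn_toLp] with w h1 h2
  rw [← h2]
  exact h1

/-- The resolvent `(1 - Δ)⁻¹` on `L²(ℝ³, ℂⁿ)`. -/
noncomputable def resolvent (n : ℕ) : L2 n →L[ℂ] L2 n :=
  (Lp.fourierTransformₗᵢ R3 (Cn n)).symm.toContinuousLinearEquiv.toContinuousLinearMap ∘L
    mulResolventSymbol n ∘L
      (Lp.fourierTransformₗᵢ R3 (Cn n)).toContinuousLinearEquiv.toContinuousLinearMap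

theorem resolvent_apply {n : ℕ} (g : L2 n) :
    resolvent n g = 𝓕⁻ (mulResolventSymbol n (𝓕 g)) := rfl

theorem fourier_resolvent {n : ℕ} (g : L2 n) :
    𝓕 (resolvent n g) = mulResolventSymbol n (𝓕 g) := by
  rw [resolvent_apply, FourierTransform.fourier_fourierInv_eq]

theorem isSymmetric_resolvent (n : ℕ) : (resolvent n).IsSymmetric := by
  intro f g
  change inner ℂ (resolvent n f) g = inner ℂ f (resolvent n g)
  rw [← Lp.inner_fourier_eq, ← Lp.inner_fourier_eq f, fourier_resolvent, fourier_resolvent,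
    L2.inner_def, L2.inner_def]
  refine integral_congr_ae ?_
  filter_upwards [coeFn_mulResolventSymbol (𝓕 f), coeFn_mulResolventSymbol (𝓕 g)] with w h1 h2
  rw [h1, h2, inner_smul_left, inner_smul_right, Complex.conj_ofReal]

/-- This passes from multiplication on `L²` to Fourier multipliers of distributions, where the
product with the symbol of `1 - Δ` can be formed. -/
theorem toDist_resolvent {n : ℕ} (g : L2 n) :
    toDist n (resolvent n g) = TemperedDistribution.fourierMultiplierCLM (Cn n)
      (fun w => (resolventSymbol w : ℂ)) (toDist n g) := by
  have h1 : toDist n (resolvent n g) = 𝓕⁻ (toDist n (mulResolventSymbol n (𝓕 g))) :=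
    (Lp.fourierInv_toTemperedDistribution_eq _).symm
  have h2 : 𝓕 (toDist n g) = toDist n (𝓕 g) := Lp.fourier_toTemperedDistribution_eq _
  rw [h1, TemperedDistribution.fourierMultiplierCLM_apply, h2]
  congr 1
  ext1 u
  rw [TemperedDistribution.smulLeftCLM_apply_apply, Lp.toTemperedDistributionCLM_apply,
    Lp.toTemperedDistributionCLM_apply, Lp.toTemperedDistribution_apply,
    Lp.toTemperedDistribution_apply]
  refine integral_congr_ae ?_
  filter_upwards [coeFn_mulResolventSymbol (𝓕 g)] with w hw
  rw [hw, SchwartzMap.smulLeftCLM_apply_apply hasTemperateGrowth_ofReal_resolventSymbol,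
    smul_smul, smul_eq_mul, mul_comm]

theorem sub_laplacian_eq {n : ℕ} (T : 𝓢'(R3, Cn n)) :
    T - Δ T = TemperedDistribution.fourierMultiplierCLM (Cn n)
      (fun w => ((1 + 4 * Real.pi ^ 2 * ‖w‖ ^ 2 : ℝ) : ℂ)) T := by
  have h1 : (fun w : R3 => ((1 + 4 * Real.pi ^ 2 * ‖w‖ ^ 2 : ℝ) : ℂ))
      = (fun _ => 1) + (((2 * Real.pi) ^ 2 : ℝ) : ℂ) • fun w : R3 => ((‖w‖ ^ 2 : ℝ) : ℂ) := by
    ext w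
    simp only [Pi.add_apply, Pi.smul_apply, smul_eq_mul]
    push_cast
    ring
  have h2 : (fun w : R3 => ((‖w‖ ^ 2 : ℝ) : ℂ)).HasTemperateGrowth := by fun_prop
  rw [TemperedDistribution.laplacian_eq_fourierMultiplierCLM,
    TemperedDistribution.fourierMultiplierCLM_apply,
    TemperedDistribution.fourierMultiplierCLM_apply, h1,
    TemperedDistribution.smulLeftCLM_add (by fun_prop) (by fun_prop),
    TemperedDistribution.smulLeftCLM_smul h2, add_apply,
    TemperedDistribution.smulLeftCLM_const, one_smul, FourierTransform.fourierInv_add,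
    FourierTransform.fourierInv_fourier_eq, smul_apply,
    FourierTransform.fourierInv_smul, neg_smul, sub_neg_eq_add]
  rfl

theorem resolvent_sub_laplacian {n : ℕ} (g : L2 n) :
    toDist n (resolvent n g) - Δ (toDist n (resolvent n g)) = toDist n g := by
  rw [sub_laplacian_eq, toDist_resolvent,
    TemperedDistribution.fourierMultiplierCLM_fourierMultiplierCLM_apply
      hasTemperateGrowth_ofReal_resolventSymbol (by fun_prop)]
  have h : ((fun w : R3 => (resolventSymbol w : ℂ)) *
      fun w : R3 => ((1 + 4 * Real.pi ^ 2 * ‖w‖ ^ 2 : ℝ) : ℂ)) = fun _ => 1 := by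
    ext w
    have : (1 + 4 * Real.pi ^ 2 * ‖w‖ ^ 2) ≠ 0 := by positivity
    rw [Pi.mul_apply, ← Complex.ofReal_mul, resolventSymbol, inv_mul_cancel₀ this,
      Complex.ofReal_one]
  rw [h, TemperedDistribution.fourierMultiplierCLM_const, one_smul, ContinuousLinearMap.id_apply]

theorem resolvent_eq_of_sub_laplacian {n : ℕ} {f g : L2 n}
    (h : toDist n f - Δ (toDist n f) = toDist n g) : resolvent n g = f := by
  apply toDist_injective n
  rw [toDist_resolvent, ← h, sub_laplacian_eq,
    TemperedDistribution.fourierMultiplierCLM_fourierMultiplierCLM_apply (by fun_prop)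
      hasTemperateGrowth_ofReal_resolventSymbol]
  have h : ((fun w : R3 => ((1 + 4 * Real.pi ^ 2 * ‖w‖ ^ 2 : ℝ) : ℂ)) *
      fun w : R3 => (resolventSymbol w : ℂ)) = fun _ => 1 := by
    ext w
    have : (1 + 4 * Real.pi ^ 2 * ‖w‖ ^ 2) ≠ 0 := by positivity
    rw [Pi.mul_apply, ← Complex.ofReal_mul, resolventSymbol, mul_inv_cancel₀ this,
      Complex.ofReal_one]
  rw [h, TemperedDistribution.fourierMultiplierCLM_const, one_smul, ContinuousLinearMap.id_apply]

/-- The Bessel potential of order two has symbol `1 + |w|²`, and its product with the resolvent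
symbol is bounded by `1`. -/
theorem memSobolev_two_resolvent {n : ℕ} (g : L2 n) :
    TemperedDistribution.MemSobolev 2 2 (toDist n (resolvent n g)) := by
  rw [show (2 : ℝ) = 2 + 0 by norm_num, ← TemperedDistribution.memSobolev_besselPotential_iff,
    TemperedDistribution.besselPotential, toDist_resolvent,
    TemperedDistribution.fourierMultiplierCLM_fourierMultiplierCLM_apply
      hasTemperateGrowth_ofReal_resolventSymbol (by fun_prop)]
  refine TemperedDistribution.MemSobolev.fourierMultiplierCLM_of_bounded
    (TemperedDistribution.memSobolev_zero_iff.2 ⟨g, rfl⟩)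
    (hasTemperateGrowth_ofReal_resolventSymbol.mul (by fun_prop)) ⟨1, fun w => ?_⟩
  have h0 := resolventSymbol_pos w
  rw [Pi.mul_apply, ← Complex.ofReal_mul, Complex.norm_real,
    div_self (two_ne_zero' ℝ), Real.rpow_one, Real.norm_of_nonneg (by positivity), mul_comm]
  exact one_add_norm_sq_mul_resolventSymbol_le w

theorem isL2_of_memSobolev {n : ℕ} {s : ℝ} (hs : 0 ≤ s) {T : 𝓢'(R3, Cn n)}
    (h : TemperedDistribution.MemSobolev s 2 T) : IsL2 T := by
  obtain ⟨f, hf⟩ := TemperedDistribution.memSobolev_zero_iff.1 (h.mono hs)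
  exact ⟨f, hf.symm⟩

theorem resolvent_mem_W22 {n : ℕ} (g : L2 n) : resolvent n g ∈ W22 n := by
  have h := memSobolev_two_resolvent g
  exact ⟨fun v => isL2_of_memSobolev (by norm_num) (h.lineDerivOp (m := v)),
    fun v w => isL2_of_memSobolev (by norm_num) ((h.lineDerivOp (m := w)).lineDerivOp (m := v))⟩

theorem resolvent_add_negLaplacian {n : ℕ} (f : (negLaplacian n).domain) :
    resolvent n (f + negLaplacian n f) = f := by
  apply resolvent_eq_of_sub_laplacian
  rw [map_add, toDist_negLaplacian, sub_eq_add_neg]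

theorem negLaplacian_resolvent {n : ℕ} (g : L2 n) :
    negLaplacian n ⟨resolvent n g, resolvent_mem_W22 g⟩ = g - resolvent n g := by
  apply toDist_injective n
  rw [toDist_negLaplacian, map_sub, ← resolvent_sub_laplacian g]
  abel

theorem resolvent_eq_zero {n : ℕ} {g : L2 n} (h : resolvent n g = 0) : g = 0 := by
  apply toDist_injective n
  rw [← resolvent_sub_laplacian g, h, map_zero, ← TemperedDistribution.laplacianCLM_apply, map_zero,
    sub_zero]

theorem mem_W22_iff {n : ℕ} {f : L2 n} : f ∈ W22 n ↔ ∃ g, resolvent n g = f :=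
  ⟨fun hf => ⟨_, resolvent_add_negLaplacian ⟨f, hf⟩⟩, fun ⟨g, hg⟩ => hg ▸ resolvent_mem_W22 g⟩

/-! ### The resolvent and the functions `ξ e^{-|y-a|}/|y-a|`, `ξ e^{-|y-a|}` -/

theorem fourier_translate_smul {n : ℕ} (φ : R3 → ℂ) (a : R3) (ξ : Cn n) (w : R3) :
    𝓕 (fun y => φ (y - a) • ξ) w = ((Real.fourierChar (-⟪a, w⟫) : ℂ) * 𝓕 φ w) • ξ := by
  rw [Real.fourier_eq, Real.fourier_eq, ← integral_add_right_eq_self _ a, ← smul_eq_mul,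
    ← integral_smul, ← integral_smul_const]
  congr 1
  ext1 v
  rw [add_sub_cancel_right, inner_add_left, neg_add, AddChar.map_add_eq_mul, Circle.smul_def,
    Circle.smul_def, Circle.coe_mul, smul_smul, smul_eq_mul, smul_eq_mul]
  congr 1
  ring

theorem fourier_expDiv {n : ℕ} (a : R3) (ξ : Cn n) :
    ((𝓕 (expDiv a ξ) : L2 n) : R3 → Cn n) =ᵐ[volume] fun w =>
      ((Real.fourierChar (-⟪a, w⟫) : ℂ) * ((4 * Real.pi * resolventSymbol w : ℝ) : ℂ)) • ξ := by
  have h1 : Integrable fun y : R3 => ((Real.exp (-‖y - a‖) / ‖y - a‖ : ℝ) : ℂ) • ξ :=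
    (integrable_exp_div.comp_sub_right a).ofReal.smul_const ξ
  filter_upwards [fourier_toLp_ae_eq h1 (memLp_exp_div a ξ)] with w hw
  rw [expDiv, hw, ← fourier_exp_div]
  exact fourier_translate_smul (fun v => ((Real.exp (-‖v‖) / ‖v‖ : ℝ) : ℂ)) a ξ w

theorem fourier_expDecay {n : ℕ} (a : R3) (ξ : Cn n) :
    ((𝓕 (expDecay a ξ) : L2 n) : R3 → Cn n) =ᵐ[volume] fun w =>
      ((Real.fourierChar (-⟪a, w⟫) : ℂ) * ((8 * Real.pi * resolventSymbol w ^ 2 : ℝ) : ℂ)) • ξ := by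
  have h1 : Integrable fun y : R3 => ((Real.exp (-‖y - a‖) : ℝ) : ℂ) • ξ :=
    (integrable_exp.comp_sub_right a).ofReal.smul_const ξ
  filter_upwards [fourier_toLp_ae_eq h1 (memLp_exp a ξ)] with w hw
  rw [expDecay, hw, ← fourier_exp]
  exact fourier_translate_smul (fun v => ((Real.exp (-‖v‖) : ℝ) : ℂ)) a ξ w

/-- On the Fourier side this is `8πσ² = σ · 2 · 4πσ`. -/
theorem expDecay_eq_resolvent {n : ℕ} (a : R3) (ξ : Cn n) :
    expDecay a ξ = resolvent n ((2 : ℂ) • expDiv a ξ) := by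
  apply (Lp.fourierTransformₗᵢ R3 (Cn n)).injective
  change 𝓕 (expDecay a ξ) = 𝓕 (resolvent n ((2 : ℂ) • expDiv a ξ))
  rw [fourier_resolvent, FourierTransform.fourier_smul, map_smul]
  apply Lp.ext
  filter_upwards [fourier_expDecay a ξ, fourier_expDiv a ξ,
    coeFn_mulResolventSymbol (𝓕 (expDiv a ξ)),
    Lp.coeFn_smul (2 : ℂ) (mulResolventSymbol n (𝓕 (expDiv a ξ)))] with w h1 h2 h3 h4
  rw [h1, h4, Pi.smul_apply, h3, h2, smul_smul, smul_smul]
  congr 1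
  push_cast
  ring

theorem integrable_mulResolventSymbol {n : ℕ} (f : L2 n) :
    Integrable (mulResolventSymbol n f : R3 → Cn n) := by
  have h : MemLp (fun w : R3 => (resolventSymbol w : ℂ) • f w) 1 volume :=
    (Lp.memLp f).smul memLp_two_resolventSymbol
  exact (memLp_one_iff_integrable.1 h).congr (coeFn_mulResolventSymbol f).symm

/-- The transform of `R g` is a product of two `L²` functions, so Fourier inversion converges
absolutely and gives `u`. By Plancherel, pairing `g` with the Green function at `a` is that
inversion integral at `a`, up to `4π`. -/
theorem exists_continuous_resolvent {n : ℕ} (g : L2 n) :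
    ∃ u : R3 → Cn n, Continuous u ∧ (resolvent n g : R3 → Cn n) =ᵐ[volume] u ∧
      ∀ (a : R3) (ξ : Cn n), inner ℂ (expDiv a ξ) g = ((4 * Real.pi : ℝ) : ℂ) * inner ℂ ξ (u a) := by
  have hv := integrable_mulResolventSymbol (𝓕 g)
  refine ⟨𝓕⁻ (mulResolventSymbol n (𝓕 g) : R3 → Cn n), continuous_fourierInv hv, ?_,
    fun a ξ => ?_⟩
  · have h := fourierInv_toLp_ae_eq hv (Lp.memLp _)
    rwa [Lp.toLp_coeFn, ← resolvent_apply] at h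
  · have hint : Integrable fun w : R3 =>
        Real.fourierChar ⟪w, a⟫ • (mulResolventSymbol n (𝓕 g) : R3 → Cn n) w := by
      have := (Real.fourierIntegral_convergent_iff (-a)).2 hv
      simpa using this
    rw [← Lp.inner_fourier_eq, L2.inner_def, Real.fourierInv_eq, ← integral_inner hint,
      ← integral_const_mul]
    refine integral_congr_ae ?_
    filter_upwards [fourier_expDiv a ξ, coeFn_mulResolventSymbol (𝓕 g)] with w h1 h2
    rw [h1, h2, Circle.smul_def, inner_smul_left, inner_smul_right, inner_smul_right, map_mul,
      Complex.conj_ofReal, ← Circle.coe_inv_eq_conj, AddChar.map_neg_eq_inv, inv_inv,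
      real_inner_comm]
    push_cast
    ring

theorem expDiv_add {n : ℕ} (a : R3) (ξ η : Cn n) :
    expDiv a (ξ + η) = expDiv a ξ + expDiv a η := by
  rw [expDiv, expDiv, expDiv, ← MemLp.toLp_add]
  congr 1
  ext1 y
  exact smul_add _ _ _

theorem expDiv_smul {n : ℕ} (a : R3) (c : ℂ) (ξ : Cn n) :
    expDiv a (c • ξ) = c • expDiv a ξ := by
  rw [expDiv, expDiv, ← MemLp.toLp_const_smul]
  congr 1
  ext1 y
  exact smul_comm _ _ _

/-- The map `ξ ↦ ξ e^{-|y-a|}/|y-a|`. -/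
noncomputable def expDivₗ (n : ℕ) (a : R3) : Cn n →ₗ[ℂ] L2 n where
  toFun := expDiv a
  map_add' := expDiv_add a
  map_smul' := expDiv_smul a

/-- The map `ξ ↦ ∑_j ξ_j e^{-r_j}/r_j`. -/
noncomputable def singularMap {m : ℕ} (n : ℕ) (x : Fin m → R3) : BdSpace m n →L[ℂ] L2 n :=
  ∑ j, (expDivₗ n (x j)).toContinuousLinearMap ∘L PiLp.proj 2 (fun _ : Fin m => Cn n) j

theorem singularMap_apply {m n : ℕ} (x : Fin m → R3) (ξ : BdSpace m n) :
    singularMap n x ξ = ∑ j, expDiv (x j) (ξ j) := by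
  rw [singularMap, sum_apply]
  rfl

theorem singularSum_eq {m n : ℕ} (x : Fin m → R3) (ξ₀ ξ₁ : Fin m → Cn n) :
    singularSum x ξ₀ ξ₁ = singularMap n x (WithLp.toLp 2 ξ₀)
      + resolvent n ((2 : ℂ) • singularMap n x (WithLp.toLp 2 ξ₁)) := by
  simp only [singularSum, singularMap_apply, Finset.sum_add_distrib, expDecay_eq_resolvent,
    Finset.smul_sum, map_sum]

/-- The pointwise representative of `singularMap n x ξ`. -/
noncomputable def singularFun {m n : ℕ} (x : Fin m → R3) (ξ : BdSpace m n) (y : R3) : Cn n :=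
  ∑ j, ((Real.exp (-‖y - x j‖) / ‖y - x j‖ : ℝ) : ℂ) • ξ j

theorem coeFn_singularMap {m n : ℕ} (x : Fin m → R3) (ξ : BdSpace m n) :
    (singularMap n x ξ : R3 → Cn n) =ᵐ[volume] singularFun x ξ := by
  rw [singularMap_apply]
  have h1 : ∀ᵐ y, ∀ j, (expDiv (x j) (ξ j) : R3 → Cn n) y
      = ((Real.exp (-‖y - x j‖) / ‖y - x j‖ : ℝ) : ℂ) • ξ j :=
    ae_all_iff.2 fun j => (memLp_exp_div (x j) (ξ j)).coeFn_toLp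
  filter_upwards [h1, Lp.coeFn_finsetSum Finset.univ fun j => expDiv (x j) (ξ j)] with y hy hs
  rw [hs, Finset.sum_apply]
  exact Finset.sum_congr rfl fun j _ => hy j

theorem continuousOn_singularFun {m n : ℕ} (x : Fin m → R3) (ξ : BdSpace m n) :
    ContinuousOn (singularFun x ξ) (Set.range x)ᶜ := by
  refine continuousOn_finsetSum _ fun j _ => ContinuousOn.fun_smul ?_ continuousOn_const
  refine Complex.continuous_ofReal.comp_continuousOn (ContinuousOn.div (by fun_prop) (by fun_prop) ?_)
  intro y hy h
  exact hy ⟨j, (sub_eq_zero.1 (norm_eq_zero.1 h)).symm⟩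

/-- The regular part at the points `x_j` of `singularFun`. -/
noncomputable def regularPart {m n : ℕ} (x : Fin m → R3) : BdSpace m n →ₗ[ℂ] BdSpace m n where
  -- Division by zero gives `0`, so the `j`-th summand of `singularFun` vanishes at `x j`; `-ξ j`
  -- supplies the limit `-1` of `e^{-r}/r - 1/r`.
  toFun ξ := WithLp.toLp 2 fun j => singularFun x ξ (x j) - ξ j
  map_add' ξ η := by
    ext1 j
    simp [singularFun, Finset.sum_add_distrib]
    abel
  map_smul' c ξ := by
    ext1 j
    simp [singularFun, Finset.smul_sum, smul_sub, smul_comm c]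

/-- The matrix entries are real and depend only on the distances `‖x j - x k‖`. -/
theorem isSymmetric_regularPart {m n : ℕ} (x : Fin m → R3) :
    (regularPart (n := n) x).IsSymmetric := by
  intro ξ η
  simp only [regularPart, LinearMap.coe_mk, AddHom.coe_mk, PiLp.inner_apply, inner_sub_left,
    inner_sub_right, singularFun, sum_inner, inner_sum, inner_smul_left, inner_smul_right,
    Complex.conj_ofReal, Finset.sum_sub_distrib]
  congr 1
  rw [Finset.sum_comm]
  simp_rw [norm_sub_rev]

theorem tendsto_norm_sub_nhdsNE (a : R3) : Tendsto (fun y => ‖y - a‖) (𝓝[≠] a) (𝓝[>] 0) := by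
  refine tendsto_nhdsWithin_iff.2 ⟨?_, ?_⟩
  · have h : Continuous fun y : R3 => ‖y - a‖ := by fun_prop
    simpa using (h.tendsto a).mono_left (nhdsWithin_le_nhds (s := {a}ᶜ))
  · filter_upwards [self_mem_nhdsWithin] with y hy
    exact norm_pos_iff.2 (sub_ne_zero.2 hy)

theorem tendsto_exp_neg_sub_one_div :
    Tendsto (fun r : ℝ => Real.exp (-r) / r - r⁻¹) (𝓝[>] 0) (𝓝 (-1)) := by
  have h : HasDerivAt (fun r : ℝ => Real.exp (-r)) (-1) 0 := by
    simpa using (hasDerivAt_neg (0 : ℝ)).exp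
  have h2 := (hasDerivAt_iff_tendsto_slope.1 h).mono_left
    (nhdsWithin_mono 0 fun r (hr : 0 < r) => ne_of_gt hr)
  refine h2.congr fun r => ?_
  simp [slope_def_field, sub_div]

theorem tendsto_singularFun_sub {m n : ℕ} {x : Fin m → R3} (hx : Function.Injective x)
    (ξ : BdSpace m n) (j : Fin m) :
    Tendsto (fun y => singularFun x ξ y - ((‖y - x j‖⁻¹ : ℝ) : ℂ) • ξ j) (𝓝[≠] x j)
      (𝓝 (regularPart x ξ j)) := by
  -- Only the summand `k = j` is singular at `x j`, so the whole subtraction is charged to it.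
  have h : ∀ k, Tendsto (fun y => ((Real.exp (-‖y - x k‖) / ‖y - x k‖ : ℝ) : ℂ) • ξ k
        - if k = j then ((‖y - x j‖⁻¹ : ℝ) : ℂ) • ξ j else 0) (𝓝[≠] x j)
      (𝓝 (((Real.exp (-‖x j - x k‖) / ‖x j - x k‖ : ℝ) : ℂ) • ξ k - if k = j then ξ j else 0)) := by
    intro k
    by_cases hk : k = j
    · subst hk
      have h1 := tendsto_exp_neg_sub_one_div.comp (tendsto_norm_sub_nhdsNE (x k))
      have h2 := ((Complex.continuous_ofReal.tendsto _).comp h1).smul_const (ξ k)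
      simpa [sub_smul, Function.comp_def] using h2
    · have h0 : ‖x j - x k‖ ≠ 0 := norm_ne_zero_iff.2 (sub_ne_zero.2 fun h => hk (hx h).symm)
      have h1 : ContinuousAt (fun y => Real.exp (-‖y - x k‖) / ‖y - x k‖) (x j) :=
        ContinuousAt.div (by fun_prop) (by fun_prop) h0
      have h2 := ((Complex.continuous_ofReal.tendsto _).comp
        (h1.tendsto.mono_left (nhdsWithin_le_nhds (s := {x j}ᶜ)))).smul_const (ξ k)
      simpa [hk, Function.comp_def] using h2
  have hs := tendsto_finsetSum Finset.univ fun k _ => h k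
  simp only [Finset.sum_sub_distrib, Finset.sum_ite_eq', Finset.mem_univ, if_true] at hs
  exact hs

theorem tendsto_norm_smul_of_tendsto_sub {n : ℕ} {u : R3 → Cn n} {a : R3} {ξ l : Cn n}
    (h : Tendsto (fun y => u y - ((‖y - a‖⁻¹ : ℝ) : ℂ) • ξ) (𝓝[≠] a) (𝓝 l)) :
    Tendsto (fun y => ((‖y - a‖ : ℝ) : ℂ) • u y) (𝓝[≠] a) (𝓝 ξ) := by
  have h1 : Tendsto (fun y => ((‖y - a‖ : ℝ) : ℂ)) (𝓝[≠] a) (𝓝 ((0 : ℝ) : ℂ)) :=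
    (Complex.continuous_ofReal.tendsto _).comp
      (tendsto_nhds_of_tendsto_nhdsWithin (tendsto_norm_sub_nhdsNE a))
  have h2 := (h1.smul h).add_const ξ
  rw [Complex.ofReal_zero, zero_smul, zero_add] at h2
  refine h2.congr' ?_
  filter_upwards [self_mem_nhdsWithin] with y hy
  have : ‖y - a‖ ≠ 0 := norm_ne_zero_iff.2 (sub_ne_zero.2 hy)
  rw [smul_sub, smul_smul, ← Complex.ofReal_mul, mul_inv_cancel₀ this, Complex.ofReal_one, one_smul,
    sub_add_cancel]

theorem hasBoundaryValues {m n : ℕ} {x : Fin m → R3} (hx : Function.Injective x)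
    (ξ : BdSpace m n) {w : L2 n} {u : R3 → Cn n} (hu : Continuous u)
    (hw : (w : R3 → Cn n) =ᵐ[volume] u) :
    HasBoundaryValues x (singularMap n x ξ + w) (((4 * Real.pi : ℝ) : ℂ) • ξ)
      (WithLp.toLp 2 (fun j => u (x j)) + regularPart x ξ) := by
  refine ⟨fun y => singularFun x ξ y + u y, (continuousOn_singularFun x ξ).add hu.continuousOn,
    (Lp.coeFn_add _ _).trans ((coeFn_singularMap x ξ).add hw), fun j => ?_⟩
  have h : Tendsto (fun y => singularFun x ξ y + u y - ((‖y - x j‖⁻¹ : ℝ) : ℂ) • ξ j) (𝓝[≠] x j)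
      (𝓝 ((WithLp.toLp 2 (fun j => u (x j)) + regularPart x ξ) j)) := by
    have := ((hu.tendsto (x j)).mono_left (nhdsWithin_le_nhds (s := {x j}ᶜ))).add
      (tendsto_singularFun_sub hx ξ j)
    refine this.congr fun y => ?_
    abel
  exact ⟨ξ j, tendsto_norm_smul_of_tendsto_sub h, rfl, h⟩

theorem isOpen_compl_range {m : ℕ} (x : Fin m → R3) : IsOpen (Set.range x)ᶜ :=
  (Set.finite_range x).isClosed.isOpen_compl

theorem compl_range_mem_nhdsNE {m : ℕ} {x : Fin m → R3} (hx : Function.Injective x) (j : Fin m) :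
    (Set.range x)ᶜ ∈ 𝓝[≠] x j := by
  have h : (x '' {j}ᶜ)ᶜ ∈ 𝓝 (x j) :=
    (((Set.toFinite _).image x).isClosed.isOpen_compl).mem_nhds fun ⟨k, hk, hkj⟩ => hk (hx hkj)
  filter_upwards [mem_nhdsWithin_of_mem_nhds h, self_mem_nhdsWithin] with y hy hyj
  rintro ⟨k, rfl⟩
  exact hy ⟨k, fun hk => hyj (by rw [Set.mem_singleton_iff.1 hk]; rfl), rfl⟩

/-- Multiplied by `‖y - x j‖`, the singular function tends to `ξ j` at `x j`, while a continuous
function tends to `0`. -/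
theorem eq_zero_of_singularMap_ae_eq {m n : ℕ} {x : Fin m → R3} (hx : Function.Injective x)
    {ξ : BdSpace m n} {u : R3 → Cn n} (hu : Continuous u)
    (h : (singularMap n x ξ : R3 → Cn n) =ᵐ[volume] u) : ξ = 0 := by
  have heq : Set.EqOn (singularFun x ξ) u (Set.range x)ᶜ :=
    Measure.eqOn_open_of_ae_eq (ae_restrict_of_ae ((coeFn_singularMap x ξ).symm.trans h))
      (isOpen_compl_range x) (continuousOn_singularFun x ξ) hu.continuousOn
  ext1 j
  have h1 := tendsto_norm_smul_of_tendsto_sub (tendsto_singularFun_sub hx ξ j)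
  have h2 : Tendsto (fun y => ((‖y - x j‖ : ℝ) : ℂ) • u y) (𝓝[≠] x j) (𝓝 0) := by
    have hc : Continuous fun y => ((‖y - x j‖ : ℝ) : ℂ) • u y := by fun_prop
    simpa using (hc.tendsto (x j)).mono_left (nhdsWithin_le_nhds (s := {x j}ᶜ))
  refine tendsto_nhds_unique (h1.congr' ?_) h2
  filter_upwards [compl_range_mem_nhdsNE hx j] with y hy
  rw [heq hy]

/-! ### The minimal operator as a resolvent restriction -/

theorem exists_continuous_resolvent_adjoint {m n : ℕ} (x : Fin m → R3) (g : L2 n) :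
    ∃ u : R3 → Cn n, Continuous u ∧ (resolvent n g : R3 → Cn n) =ᵐ[volume] u ∧
      ContinuousLinearMap.adjoint (singularMap n x) g
        = ((4 * Real.pi : ℝ) : ℂ) • WithLp.toLp 2 fun j => u (x j) := by
  obtain ⟨u, hu, hae, hin⟩ := exists_continuous_resolvent g
  refine ⟨u, hu, hae, ext_inner_left ℂ fun ξ => ?_⟩
  rw [ContinuousLinearMap.adjoint_inner_right, singularMap_apply, sum_inner, inner_smul_right,
    PiLp.inner_apply, Finset.mul_sum]
  exact Finset.sum_congr rfl fun j _ => hin _ _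

/-- The point values of `R g` are, up to `4π`, the components of `G* g`, and `ker G* = (ran G)ᗮ`. -/
theorem resolvent_mem_vanishingAt_iff {m n : ℕ} (x : Fin m → R3) (g : L2 n) :
    resolvent n g ∈ vanishingAt n x ↔ g ∈ (singularMap n x).rangeᗮ := by
  obtain ⟨u, hu, hae, hG⟩ := exists_continuous_resolvent_adjoint x g
  have hc : ((4 * Real.pi : ℝ) : ℂ) ≠ 0 :=
    Complex.ofReal_ne_zero.2 (mul_ne_zero four_ne_zero Real.pi_ne_zero)
  have h1 : g ∈ (singularMap n x).rangeᗮ ↔ ∀ j, u (x j) = 0 := by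
    rw [ContinuousLinearMap.orthogonal_range, LinearMap.mem_ker, ContinuousLinearMap.coe_coe, hG,
      smul_eq_zero, or_iff_right hc]
    constructor
    · intro h j
      exact congrArg (fun ξ : BdSpace m n => ξ j) h
    · intro h
      ext1 j
      exact h j
  rw [h1]
  constructor
  · rintro ⟨v, hv, hgv, hv0⟩ j
    rw [← hv0 j]
    exact congrFun (Measure.eq_of_ae_eq (hae.symm.trans hgv) hu hv) (x j)
  · exact fun h => ⟨u, hu, hae, h⟩

theorem isResolventRestriction_minimalOp {m n : ℕ} (x : Fin m → R3) :
    IsResolventRestriction (resolvent n) (singularMap n x).range (minimalOp n x) := by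
  intro p
  rw [LinearPMap.mem_graph_iff]
  constructor
  · rintro ⟨f, hf, hf'⟩
    have hW : (f : L2 n) ∈ W22 n := f.2.2
    let f' : (negLaplacian n).domain := ⟨(f : L2 n), hW⟩
    have h1 : minimalOp n x f = negLaplacian n f' := LinearPMap.domRestrict_apply rfl
    have h2 : resolvent n (p.1 + p.2) = p.1 := by
      have h3 := resolvent_add_negLaplacian f'
      rw [← h1, hf'] at h3
      rw [← hf]
      exact h3
    refine ⟨h2, ?_⟩
    rw [← resolvent_mem_vanishingAt_iff, h2, ← hf]
    exact f.2.1
  · rintro ⟨h1, h2⟩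
    rw [← resolvent_mem_vanishingAt_iff, h1] at h2
    have h3 : p.1 ∈ W22 n := mem_W22_iff.2 ⟨_, h1⟩
    refine ⟨⟨p.1, h2, h3⟩, rfl, ?_⟩
    have h4 : minimalOp n x ⟨p.1, h2, h3⟩ = negLaplacian n ⟨p.1, h3⟩ :=
      LinearPMap.domRestrict_apply rfl
    have h5 : negLaplacian n ⟨p.1, h3⟩
        = negLaplacian n ⟨resolvent n (p.1 + p.2), resolvent_mem_W22 _⟩ := by
      congr 1
      exact Subtype.ext h1.symm
    rw [h4, h5, negLaplacian_resolvent, h1, add_sub_cancel_left]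

theorem singularMap_injective {m n : ℕ} {x : Fin m → R3} (hx : Function.Injective x) :
    Function.Injective (singularMap n x) := by
  rw [injective_iff_map_eq_zero]
  intro ξ h
  refine eq_zero_of_singularMap_ae_eq hx continuous_zero ?_
  rw [h]
  exact Lp.coeFn_zero _ _ _

theorem eq_zero_of_resolvent_mem_range {m n : ℕ} {x : Fin m → R3} (hx : Function.Injective x)
    (g : L2 n) (h : resolvent n g ∈ (singularMap n x).range) : g = 0 := by
  obtain ⟨ξ, hξ⟩ := h
  obtain ⟨u, hu, hae, -⟩ := exists_continuous_resolvent g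
  rw [← hξ] at hae
  have h0 : ξ = 0 := eq_zero_of_singularMap_ae_eq hx hu hae
  apply resolvent_eq_zero
  rw [← hξ, h0]
  exact map_zero (singularMap n x)

theorem mem_domain_adjoint_minimalOp_iff {m n : ℕ} {x : Fin m → R3} (hx : Function.Injective x)
    {f : L2 n} : f ∈ (minimalOp n x)†.domain ↔ ∃ ξ₀ ξ₁ : Fin m → Cn n,
      ∃ fH ∈ (minimalOp n x).domain, f = singularSum x ξ₀ ξ₁ + fH := by
  have hH := isResolventRestriction_minimalOp (n := n) x
  rw [hH.mem_domain_adjoint_iff (isSymmetric_resolvent n) (eq_zero_of_resolvent_mem_range hx)]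
  constructor
  · rintro ⟨_, ⟨ξ, rfl⟩, g, rfl⟩
    -- The part of `g` in `ran G` produces the terms `e^{-r_j}`, the orthogonal part produces `f_H`;
    -- the factor `2⁻¹` below undoes the `2` in `e^{-r} = R (2 e^{-r}/r)`.
    obtain ⟨k, ⟨η, rfl⟩, g', hg', rfl⟩ := (singularMap n x).range.exists_add_mem_mem_orthogonal g
    refine ⟨ξ, ((2 : ℂ)⁻¹ • η : BdSpace m n), resolvent n g', hH.mem_domain_iff.2 ⟨g', hg', rfl⟩, ?_⟩
    rw [singularSum_eq, map_add, add_assoc, WithLp.toLp_ofLp, WithLp.toLp_ofLp, ← map_smul, smul_smul,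
      mul_inv_cancel₀ two_ne_zero, one_smul]
    rfl
  · rintro ⟨ξ₀, ξ₁, fH, hfH, rfl⟩
    obtain ⟨g, -, rfl⟩ := hH.mem_domain_iff.1 hfH
    rw [singularSum_eq, add_assoc, ← map_add]
    exact ⟨_, ⟨_, rfl⟩, _, rfl⟩

/-- Uniqueness of the decomposition kills `ξ₀` and puts `g` both in `ran G` and in its orthogonal
complement. -/
theorem eq_zero_of_singularSum_mem_domain {m n : ℕ} {x : Fin m → R3} (hx : Function.Injective x)
    {ξ₀ ξ₁ : Fin m → Cn n} (h : singularSum x ξ₀ ξ₁ ∈ (minimalOp n x).domain) :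
    ξ₀ = 0 ∧ ξ₁ = 0 := by
  obtain ⟨g, hg, hgs⟩ := (isResolventRestriction_minimalOp (n := n) x).mem_domain_iff.1 h
  have hG := singularMap_injective (n := n) hx
  have h1 : singularMap n x (WithLp.toLp 2 ξ₀)
      + resolvent n ((2 : ℂ) • singularMap n x (WithLp.toLp 2 ξ₁))
      = singularMap n x 0 + resolvent n g := by
    rw [← singularSum_eq, map_zero, zero_add, hgs]
  obtain ⟨e0, e1⟩ := IsResolventRestriction.singularPart_unique
    (eq_zero_of_resolvent_mem_range hx) hG h1
  have hmem : g ∈ (singularMap n x).range := ⟨(2 : ℂ) • WithLp.toLp 2 ξ₁, by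
    rw [← e1, map_smul]
    rfl⟩
  have hg0 : g = 0 := by
    rw [← inner_self_eq_zero (𝕜 := ℂ)]
    exact (Submodule.mem_orthogonal _ _).1 hg g hmem
  rw [hg0, smul_eq_zero, or_iff_right two_ne_zero] at e1
  have e2 : WithLp.toLp 2 ξ₁ = (0 : BdSpace m n) := hG (by rw [e1, map_zero])
  exact ⟨congrArg WithLp.ofLp e0, congrArg WithLp.ofLp e2⟩

end PointInteraction

open PointInteraction in
theorem proposition4p1 (m n : ℕ) (x : Fin m → PointInteraction.R3)
    (hx : Function.Injective x) :
    -- (i) the domain of `H*`; the sum is direct and the coefficients are unique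
    (((PointInteraction.minimalOp n x)†.domain : Set (PointInteraction.L2 n)) =
      {f | ∃ ξ₀ ξ₁ : Fin m → PointInteraction.Cn n,
        ∃ fH ∈ (PointInteraction.minimalOp n x).domain,
          f = PointInteraction.singularSum x ξ₀ ξ₁ + fH}) ∧
    (∀ ξ₀ ξ₁ : Fin m → PointInteraction.Cn n,
      PointInteraction.singularSum x ξ₀ ξ₁ ∈ (PointInteraction.minimalOp n x).domain →
        ξ₀ = 0 ∧ ξ₁ = 0) ∧
    -- (ii) the limits define linear maps on `dom H*` that form a boundary triplet
    ∃ Γ₀ Γ₁ : (PointInteraction.minimalOp n x)†.domain →ₗ[ℂ] PointInteraction.BdSpace m n,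
      (∀ f : (PointInteraction.minimalOp n x)†.domain,
        PointInteraction.HasBoundaryValues x (f : PointInteraction.L2 n) (Γ₀ f) (Γ₁ f)) ∧
      (∀ f : (PointInteraction.minimalOp n x)†.domain,
        ∀ ξ₀ ξ₁ : Fin m → PointInteraction.Cn n,
          ∀ fH ∈ (PointInteraction.minimalOp n x).domain,
            (f : PointInteraction.L2 n) = PointInteraction.singularSum x ξ₀ ξ₁ + fH →
              ∀ j, Γ₀ f j = ((4 * Real.pi : ℝ) : ℂ) • ξ₀ j) ∧
      PointInteraction.IsBoundaryTriplet (PointInteraction.minimalOp n x) Γ₀ Γ₁ ∧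
    -- (iii) the extension `H₀`
      IsSelfAdjoint
        (PointInteraction.adjointRestrictKer (PointInteraction.minimalOp n x) Γ₀) ∧
      (PointInteraction.adjointRestrictKer (PointInteraction.minimalOp n x) Γ₀).domain =
        PointInteraction.W22 n := by
  have hH := isResolventRestriction_minimalOp (n := n) x
  have hR := isSymmetric_resolvent n
  have hinj := eq_zero_of_resolvent_mem_range (n := n) hx
  have hG := singularMap_injective (n := n) hx
  refine ⟨Set.ext fun f => mem_domain_adjoint_minimalOp_iff hx,
    fun _ _ => eq_zero_of_singularSum_mem_domain hx, ?_⟩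
  obtain ⟨κ, hκ⟩ := hH.exists_singularPart hR hinj hG
  have hc : (4 * Real.pi : ℝ) ≠ 0 := mul_ne_zero four_ne_zero Real.pi_ne_zero
  have hc' : ((4 * Real.pi : ℝ) : ℂ) ≠ 0 := Complex.ofReal_ne_zero.2 hc
  let Γ₀ : (minimalOp n x)†.domain →ₗ[ℂ] BdSpace m n := ((4 * Real.pi : ℝ) : ℂ) • κ
  -- The first term is the vector of values at the `x j` of the continuous part `R (f + H* f)`, the
  -- second the regular part of `G (κ f)`.
  let Γ₁ : (minimalOp n x)†.domain →ₗ[ℂ] BdSpace m n :=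
    ((4 * Real.pi : ℝ) : ℂ)⁻¹ • ((ContinuousLinearMap.adjoint (singularMap n x)).toLinearMap ∘ₗ
      ((minimalOp n x)†.domain.subtype + (minimalOp n x)†.toFun)) + regularPart x ∘ₗ κ
  have h₀ : ∀ f, Γ₀ f = ((4 * Real.pi : ℝ) : ℂ) • κ f := fun _ => rfl
  have h₁ : ∀ f, Γ₁ f = ((4 * Real.pi : ℝ) : ℂ)⁻¹ •
      ContinuousLinearMap.adjoint (singularMap n x) (f + (minimalOp n x)† f)
        + regularPart x (κ f) := fun _ => rfl
  have hres : IsResolventRestriction (resolvent n) ⊥ (adjointRestrictKer (minimalOp n x) Γ₀) :=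
    hH.adjointRestrictKer hR hinj hG hκ fun f => by
      rw [h₀, smul_eq_zero, or_iff_right hc']
  refine ⟨Γ₀, Γ₁, fun f => ?_, fun f ξ₀ ξ₁ fH hfH hf j => ?_,
    hH.isBoundaryTriplet hR hinj hG (isSymmetric_regularPart x) hc hκ h₀ h₁,
    hres.isSelfAdjoint hR fun _ => resolvent_eq_zero, ?_⟩
  · obtain ⟨u, hu, hae, hadj⟩ := exists_continuous_resolvent_adjoint x
      ((f : L2 n) + (minimalOp n x)† f)
    rw [h₀, h₁, hadj, smul_smul, inv_mul_cancel₀ hc', one_smul]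
    have hb := hasBoundaryValues hx (κ f) hu hae
    rwa [← hκ f] at hb
  · obtain ⟨g, -, rfl⟩ := hH.mem_domain_iff.1 hfH
    rw [singularSum_eq, add_assoc, ← map_add] at hf
    rw [h₀, (IsResolventRestriction.singularPart_unique hinj hG ((hκ f).symm.trans hf)).1]
    rfl
  · ext f
    rw [hres.mem_domain_iff, mem_W22_iff]
    simp
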